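/- Let $(S,\rho)$ be a nonempty bounded separable metric space (for instance a compact one) and let $\mathfrak N$ be the set of finite counting measures $\mu=\sum_{i=1}^{m}\delta_{x_i}$, $x_i\in S$, with the $\sigma$-algebra generated by the point counts $\mu\mapsto\mu(B)$, $B\subseteq S$ Borel; write $|\mu|=\mu(S)$. Extend $\rho$ to a metric on $S\cup\{s_\alpha\}$, where $s_\alpha\notin S$ is an additional point, and let $\alpha=\inf_{s\in S}\rho(s,s_\alpha)$. For $\mu_1=\sum_{i=1}^{k}\delta_{x_i}$ and $\mu_2=\sum_{i=1}^{m}\delta_{y_i}$ with $k\le m$ put $$D_1(\mu_1,\mu_2)=D_1(\mu_2,\mu_1)=\min_{\pi}\Big[\sum_{i=1}^{k}\rho(x_i,y_{\pi(i)})+\sum_{i=k+1}^{m}\rho(s_\alpha,y_{\pi(i)})\Big],$$ the minimum being over the permutations $\pi$ of $\{1,\dots,m\}$. For $p\in[1,\infty)$ and probability measures $Q_1,Q_2$ on $\mathfrak N$ let $$W_p(Q_1,Q_2)=\Big(\inf_{\gamma}\int D_1(\mu,\nu)^p\,d\gamma(\mu,\nu)\Big)^{1/p},$$ the infimum being over the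 measures $\gamma$ on $\mathfrak N\times\mathfrak N$ with marginals $Q_1$ and $Q_2$. Let $\eta$ be a point process, that is, a random element of $\mathfrak N$, with law $\mathcal L(\eta)$, and suppose that there are constants $K_1>0$ and $\lambda>0$ such that $P(|\eta|=m)\le K_1e^{-\lambda m}$ for every integer $m\ge 0$. Let $n\ge1$, let $\eta_1,\dots,\eta_n$ be i.i.d. random elements of $\mathfrak N$ with the law of $\eta$, and let $\widehat{\mathcal L}_n(\eta)=\frac1n\sum_{i=1}^{n}\delta_{\eta_i}$. Then $W_p(\widehat{\mathcal L}_n(\eta),\mathcal L(\eta))$ is finite and integrable, and for every $\varepsilon>0$ $$P\Big(W_p\big(\widehat{\mathcal L}_n(\eta),\mathcal L(\eta)\big)-E\big[W_p\big(\widehat{\mathcal L}_n(\eta),\mathcal L(\eta)\big)\big]>\varepsilon\Big)\le\exp\left(-\frac{\varepsilon^2\lambda^3}{16K_1e^{\lambda}(\mathrm{diam}(S)+\alpha)^2n^{1-2/p}+4\lambda^2\varepsilon(\mathrm{diam}(S)+\alpha)n^{-1/p}}\right).$$ -/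

import Mathlib

open MeasureTheory ProbabilityTheory
open scoped ENNReal

/-- The space `𝔑(S)` of finite counting measures on `S`: the finite sums of Dirac measures.
As a subtype of `Measure S` it carries the `σ`-algebra generated by the point counts
`μ ↦ μ B`, `B ⊆ S` measurable. -/
abbrev CountingMeasure (S : Type*) [MeasurableSpace S] : Type _ :=
  {μ : Measure S // ∃ (n : ℕ) (x : Fin n → S), μ = ∑ i, Measure.dirac (x i)}

namespace CountingMeasure

variable {S : Type*} [MeasurableSpace S]

/-- The number `|μ|` of points of `μ`, counted with multiplicity. -/
noncomputable def size (μ : CountingMeasure S) : ℕ := μ.2.choose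

/-- An enumeration `x₁, …, x_n` of the points of `μ = δ_{x₁} + ⋯ + δ_{x_n}`, `n = |μ|`. -/
noncomputable def points (μ : CountingMeasure S) : Fin μ.size → S := μ.2.choose_spec.choose

theorem eq_sum_dirac (μ : CountingMeasure S) :
    (μ : Measure S) = ∑ i, Measure.dirac (μ.points i) :=
  μ.2.choose_spec.choose_spec

/-- The size is the total mass. -/
theorem size_eq_mass (μ : CountingMeasure S) : (μ.size : ℝ≥0∞) = (μ : Measure S) Set.univ := by
  rw [eq_sum_dirac μ]
  simp [Measure.finsetSum_apply]

end CountingMeasure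

/-- The points `x₁, …, x_n` of `S`, followed by copies of the additional point `s_α = none` of
`S ∪ {s_α} = Option S`, up to the total number `m` of points. -/
def padPoints {S : Type*} {n : ℕ} (m : ℕ) (x : Fin n → S) (i : Fin m) : Option S :=
  if h : (i : ℕ) < n then some (x ⟨i, h⟩) else none

/-- The minimal matching cost `min_π ∑ᵢ ρ(xᵢ, y_{π(i)})` between the point configurations
`x₁, …, x_n` and `y₁, …, y_m`, the shorter of which is padded with copies of `s_α`. -/
noncomputable def matchingCost {S : Type*} [MetricSpace (Option S)] {n m : ℕ}
    (x : Fin n → S) (y : Fin m → S) : ℝ :=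
  ⨅ π : Equiv.Perm (Fin (max n m)),
    ∑ i, dist (padPoints (max n m) x i) (padPoints (max n m) y (π i))

/-- The points of a counting measure are unique up to a permutation. -/
theorem exists_perm_of_sum_dirac_eq {S : Type*} [MeasurableSpace S] [MeasurableSingletonClass S]
    {n m : ℕ} (x : Fin n → S) (x' : Fin m → S)
    (h : ∑ i, Measure.dirac (x i) = ∑ i, Measure.dirac (x' i)) :
    ∃ σ : Fin n ≃ Fin m, ∀ i, x' (σ i) = x i := by
  classical
  have key : ∀ s : S, Fintype.card {i // x i = s} = Fintype.card {i // x' i = s} := by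
    intro s
    have h1 := congrArg (fun μ : Measure S => μ {s}) h
    simp only [Measure.finsetSum_apply, Measure.dirac_apply, Set.indicator_apply,
      Set.mem_singleton_iff, Pi.one_apply, Finset.sum_boole] at h1
    rw [Fintype.card_subtype, Fintype.card_subtype]
    exact_mod_cast h1
  refine ⟨(Equiv.sigmaFiberEquiv x).symm.trans
    ((Equiv.sigmaCongrRight fun s => Fintype.equivOfCardEq (key s)).trans
      (Equiv.sigmaFiberEquiv x')), fun i => ?_⟩
  exact (Fintype.equivOfCardEq (key (x i)) ⟨i, rfl⟩).2

theorem matchingCost_congr {S : Type*} [MetricSpace (Option S)] {n m n' m' : ℕ}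
    (x : Fin n → S) (y : Fin m → S) (x' : Fin n' → S) (y' : Fin m' → S)
    (hx : ∃ σ : Fin n ≃ Fin n', ∀ i, x' (σ i) = x i)
    (hy : ∃ σ : Fin m ≃ Fin m', ∀ i, y' (σ i) = y i) :
    matchingCost x y = matchingCost x' y' := by
  obtain ⟨σ, hσ⟩ := hx
  obtain ⟨τ, hτ⟩ := hy
  obtain rfl : n = n' := by simpa using Fintype.card_congr σ
  obtain rfl : m = m' := by simpa using Fintype.card_congr τ
  have ext : ∀ {a : ℕ} (N : ℕ) (_ : a ≤ N) (z z' : Fin a → S) (ρ : Fin a ≃ Fin a)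
      (_ : ∀ i, z' (ρ i) = z i),
      ∃ ρ' : Equiv.Perm (Fin N), ∀ i, padPoints N z' (ρ' i) = padPoints N z i := by
    intro a N haN z z' ρ hρ
    let e : Fin a ≃ {i : Fin N // (i : ℕ) < a} :=
      ⟨fun i => ⟨⟨i, by omega⟩, i.2⟩, fun i => ⟨i.1, i.2⟩, fun _ => rfl, fun _ => rfl⟩
    refine ⟨Equiv.Perm.ofSubtype (e.permCongr ρ), fun i => ?_⟩
    by_cases hi : (i : ℕ) < a
    · rw [Equiv.Perm.ofSubtype_apply_of_mem (e.permCongr ρ) hi]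
      simp [padPoints, e, Equiv.permCongr_apply, hi, ← hρ]
    · rw [Equiv.Perm.ofSubtype_apply_of_not_mem (e.permCongr ρ) hi]
      simp [padPoints, hi]
  obtain ⟨σ', hσ'⟩ := ext (max n m) (le_max_left _ _) x x' σ hσ
  obtain ⟨τ', hτ'⟩ := ext (max n m) (le_max_right _ _) y y' τ hτ
  unfold matchingCost
  refine (((Equiv.mulRight σ').trans (Equiv.mulLeft τ'⁻¹)).iInf_congr fun π => ?_).symm
  rw [← Equiv.sum_comp σ' fun i => dist (padPoints (max n m) x' i)
    (padPoints (max n m) y' (π i))]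
  refine Finset.sum_congr rfl fun i _ => ?_
  rw [hσ', ← hτ']
  simp [Equiv.Perm.mul_apply]

/-- The metric `D₁` on finite counting measures; it depends on the metric of
`S ∪ {s_α} = Option S`. -/
noncomputable def D1 {S : Type*} [MeasurableSpace S] [MetricSpace (Option S)]
    (μ ν : CountingMeasure S) : ℝ :=
  matchingCost μ.points ν.points

/-- `D₁` does not depend on the enumeration of the points. -/
theorem D1_eq {S : Type*} [MeasurableSpace S] [MeasurableSingletonClass S]
    [MetricSpace (Option S)] {n m : ℕ} (x : Fin n → S) (y : Fin m → S) :
    D1 ⟨∑ i, Measure.dirac (x i), n, x, rfl⟩ ⟨∑ i, Measure.dirac (y i), m, y, rfl⟩ =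
      matchingCost x y :=
  matchingCost_congr _ _ _ _
    (exists_perm_of_sum_dirac_eq _ _ (CountingMeasure.eq_sum_dirac _).symm)
    (exists_perm_of_sum_dirac_eq _ _ (CountingMeasure.eq_sum_dirac _).symm)

/-- The couplings of two measures on `𝔑(S)`. -/
def couplings {S : Type*} [MeasurableSpace S] (Q₁ Q₂ : Measure (CountingMeasure S)) :
    Set (Measure (CountingMeasure S × CountingMeasure S)) :=
  {γ | γ.map Prod.fst = Q₁ ∧ γ.map Prod.snd = Q₂}

/-- The Wasserstein distance `W_p` of order `p` with ground metric `D₁`. -/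
noncomputable def wassersteinDist {S : Type*} [MeasurableSpace S] [MetricSpace (Option S)]
    (p : ℝ) (Q₁ Q₂ : Measure (CountingMeasure S)) : ℝ≥0∞ :=
  (⨅ γ ∈ couplings Q₁ Q₂, ∫⁻ z, ENNReal.ofReal (D1 z.1 z.2) ^ p ∂γ) ^ (1 / p)

/-- The empirical measure `(1/n) ∑ᵢ δ_{μᵢ}` of a sample `μ₁, …, μ_n`. -/
noncomputable def empiricalMeasure {S : Type*} [MeasurableSpace S] {n : ℕ}
    (μ : Fin n → CountingMeasure S) : Measure (CountingMeasure S) :=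
  (n : ℝ≥0∞)⁻¹ • ∑ i, Measure.dirac (μ i)

/-! Put `R = diam(S) + α`, a bound for the extended metric, and let `F` be the distance from the
empirical measure to the law as a function of the sample. By the triangle inequality for `D₁` and
Minkowski's inequality, replacing one sample point `μᵢ` by `ν` changes `F` by at most `n^(-1/p)
D₁(μᵢ, ν)`, hence by at most `max (h μᵢ) (h ν)` with `h μ = n^(-1/p) R |μ|`. The differences are
unbounded, but `h` has exponential tails.

Averaging over one coordinate preserves this property in the others, so the moment generating
function is controlled one coordinate at a time (`lintegral_pi_exp_sub_integral_le`). For one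
coordinate, Jensen's inequality introduces an independent copy, symmetry turns the exponential into
`cosh`, and the factor is at most `1 + 2 E[cosh(t h) - 1]`. Comparing a sum with an integral, the
tail assumption gives `E[cosh(s|η|) - 1] ≤ K₁ e^λ s² / (λ(λ² - s²))` for `0 ≤ s < λ`. Markov's
inequality with a suitable `t` then yields the bound.

Measurability needs separate care, since the `σ`-algebra only knows point counts. Hall's theorem
expresses the existence of an enumeration in a given box through counts, which makes `D₁(·, ν)`
measurable. Separability for `D₁` writes both `D₁` and `F` as countable infima. -/

theorem padPoints_castSucc {S : Type*} {n : ℕ} (N : ℕ) (x : Fin n → S) (i : Fin N) :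
    padPoints (N + 1) x i.castSucc = padPoints N x i := by
  simp [padPoints]

theorem padPoints_last {S : Type*} {n N : ℕ} (h : n ≤ N) (x : Fin n → S) :
    padPoints (N + 1) x (Fin.last N) = none := by
  simp [padPoints, h]

/-! ### Matching costs with a free number of padding points -/

section PaddedCost

variable {S : Type*} [MetricSpace (Option S)] {n m l : ℕ}

/-- The minimal matching cost between two point configurations, both padded to `N` points. -/
noncomputable def paddedCost (N : ℕ) (x : Fin n → S) (y : Fin m → S) : ℝ :=
  ⨅ π : Equiv.Perm (Fin N), ∑ i, dist (padPoints N x i) (padPoints N y (π i))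

theorem paddedCost_le (N : ℕ) (x : Fin n → S) (y : Fin m → S) (π : Equiv.Perm (Fin N)) :
    paddedCost N x y ≤ ∑ i, dist (padPoints N x i) (padPoints N y (π i)) :=
  ciInf_le (Set.finite_range _).bddBelow π

theorem exists_paddedCost_eq (N : ℕ) (x : Fin n → S) (y : Fin m → S) :
    ∃ π : Equiv.Perm (Fin N),
      ∑ i, dist (padPoints N x i) (padPoints N y (π i)) = paddedCost N x y :=
  exists_eq_ciInf_of_finite

theorem paddedCost_nonneg (N : ℕ) (x : Fin n → S) (y : Fin m → S) : 0 ≤ paddedCost N x y :=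
  Real.iInf_nonneg fun _ => Finset.sum_nonneg fun _ _ => dist_nonneg

theorem paddedCost_swap_le (N : ℕ) (x : Fin n → S) (y : Fin m → S) :
    paddedCost N y x ≤ paddedCost N x y := by
  obtain ⟨π, hπ⟩ := exists_paddedCost_eq N x y
  rw [← hπ]
  refine (paddedCost_le N y x π⁻¹).trans_eq ?_
  rw [← Equiv.sum_comp π]
  simp [dist_comm]

theorem paddedCost_comm (N : ℕ) (x : Fin n → S) (y : Fin m → S) :
    paddedCost N x y = paddedCost N y x :=
  le_antisymm (paddedCost_swap_le N y x) (paddedCost_swap_le N x y)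

theorem paddedCost_triangle (N : ℕ) (x : Fin n → S) (y : Fin m → S) (z : Fin l → S) :
    paddedCost N x z ≤ paddedCost N x y + paddedCost N y z := by
  obtain ⟨π, hπ⟩ := exists_paddedCost_eq N x y
  obtain ⟨σ, hσ⟩ := exists_paddedCost_eq N y z
  rw [← hπ, ← hσ, ← Equiv.sum_comp π fun i => dist (padPoints N y i) (padPoints N z (σ i)),
    ← Finset.sum_add_distrib]
  refine (paddedCost_le N x z (σ * π)).trans (Finset.sum_le_sum fun i _ => ?_)
  exact dist_triangle _ _ _

/-- The last point on either side is `s_α`. If an optimal matching pairs these two, delete the pair.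
Otherwise they are paired with some `y_j` and some `x_i`; pairing `x_i` with `y_j` instead costs no
more, by the triangle inequality through `s_α`. This rerouting is `Equiv.removeNone`. -/
theorem paddedCost_le_succ {N : ℕ} (hn : n ≤ N) (hm : m ≤ N) (x : Fin n → S) (y : Fin m → S) :
    paddedCost N x y ≤ paddedCost (N + 1) x y := by
  obtain ⟨π, hπ⟩ := exists_paddedCost_eq (N + 1) x y
  rw [← hπ]
  let e : Option (Fin N) ≃ Option (Fin N) :=
    finSuccEquivLast.symm.trans (π.trans finSuccEquivLast)
  have hy : ∀ o : Option (Fin N), padPoints (N + 1) y (finSuccEquivLast.symm o) =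
      o.elim none (padPoints N y) := by
    rintro (_ | j)
    · simpa using padPoints_last hm y
    · simpa using padPoints_castSucc N y j
  have hπe : ∀ o, π (finSuccEquivLast.symm o) = finSuccEquivLast.symm (e o) := by
    intro o; simp [e]
  have hπy : ∀ i : Fin N, padPoints (N + 1) y (π i.castSucc) =
      (e (some i)).elim none (padPoints N y) := by
    intro i
    rw [← hy, ← hπe]; simp
  have hπl : padPoints (N + 1) y (π (Fin.last N)) = (e none).elim none (padPoints N y) := by
    rw [← hy, ← hπe]; simp
  refine (paddedCost_le N x y (Equiv.removeNone e)).trans ?_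
  rw [Fin.sum_univ_castSucc, padPoints_last hn, hπl]
  simp only [padPoints_castSucc, hπy]
  rcases hnone : e none with _ | j
  · refine le_add_of_le_of_nonneg (Finset.sum_le_sum fun i _ => ?_) dist_nonneg
    rcases hi : e (some i) with _ | k
    · rw [← hnone] at hi
      simpa using e.injective hi
    · have := Equiv.removeNone_some e ⟨k, hi⟩
      rw [hi, Option.some_inj] at this
      simp [this]
  · obtain ⟨i₀, hi₀⟩ : ∃ i, e (some i) = none := by
      obtain ⟨o, ho⟩ := e.surjective none
      rcases o with _ | i
      · simp [hnone] at ho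
      · exact ⟨i, ho⟩
    rw [← Finset.sum_erase_add _ _ (Finset.mem_univ i₀),
      ← Finset.sum_erase_add (a := i₀) _ _ (Finset.mem_univ i₀), add_assoc]
    refine add_le_add (Finset.sum_le_sum fun i hi => ?_) ?_
    · rcases hi' : e (some i) with _ | k
      · rw [← hi₀] at hi'
        have := e.injective hi'
        simp at this
        simp [this] at hi
      · have := Equiv.removeNone_some e ⟨k, hi'⟩
        rw [hi', Option.some_inj] at this
        simp [this]
    · have := Equiv.removeNone_none e hi₀
      rw [hnone, Option.some_inj] at this
      rw [this, hi₀]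
      exact dist_triangle _ _ _

theorem paddedCost_succ_le {N : ℕ} (hn : n ≤ N) (hm : m ≤ N) (x : Fin n → S) (y : Fin m → S) :
    paddedCost (N + 1) x y ≤ paddedCost N x y := by
  obtain ⟨π, hπ⟩ := exists_paddedCost_eq N x y
  rw [← hπ]
  refine (paddedCost_le (N + 1) x y
    (finSuccEquivLast.symm.permCongr (Equiv.optionCongr π))).trans_eq ?_
  rw [Fin.sum_univ_castSucc, padPoints_last hn]
  simp [Equiv.permCongr_apply, padPoints_castSucc, padPoints_last hm]

/-- Extra copies of `s_α` are harmless, so three configurations can be padded to a common length;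
the triangle inequality then comes from composing permutations. -/
theorem matchingCost_eq_paddedCost {N : ℕ} (hn : n ≤ N) (hm : m ≤ N) (x : Fin n → S)
    (y : Fin m → S) : matchingCost x y = paddedCost N x y := by
  have h : max n m ≤ N := max_le hn hm
  induction N, h using Nat.le_induction with
  | base => rfl
  | succ N h ih =>
    have hn' := (le_max_left n m).trans h
    have hm' := (le_max_right n m).trans h
    rw [ih hn' hm']
    exact le_antisymm (paddedCost_le_succ hn' hm' x y) (paddedCost_succ_le hn' hm' x y)

end PaddedCost

section MatchingCost

variable {S : Type*} [MetricSpace (Option S)] {n m l : ℕ}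

theorem matchingCost_nonneg (x : Fin n → S) (y : Fin m → S) : 0 ≤ matchingCost x y :=
  paddedCost_nonneg _ x y

theorem matchingCost_comm (x : Fin n → S) (y : Fin m → S) :
    matchingCost x y = matchingCost y x := by
  rw [matchingCost_eq_paddedCost (le_max_left n m) (le_max_right n m), paddedCost_comm,
    matchingCost_eq_paddedCost (le_max_right n m) (le_max_left n m)]

theorem matchingCost_triangle (x : Fin n → S) (y : Fin m → S) (z : Fin l → S) :
    matchingCost x z ≤ matchingCost x y + matchingCost y z := by
  have h₁ : n ≤ n + m + l := by omega
  have h₂ : m ≤ n + m + l := by omega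
  have h₃ : l ≤ n + m + l := by omega
  rw [matchingCost_eq_paddedCost h₁ h₂, matchingCost_eq_paddedCost h₁ h₃,
    matchingCost_eq_paddedCost h₂ h₃]
  exact paddedCost_triangle _ x y z

theorem matchingCost_le_mul_max {R : ℝ} (hR : ∀ a b : Option S, dist a b ≤ R) (x : Fin n → S)
    (y : Fin m → S) : matchingCost x y ≤ R * max n m := by
  refine (paddedCost_le (max n m) x y 1).trans ((Finset.sum_le_sum fun i _ => hR _ _).trans_eq ?_)
  simp [mul_comm]

theorem matchingCost_le_sum_dist (x y : Fin n → S) :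
    matchingCost x y ≤ ∑ i, dist (some (x i)) (some (y i)) := by
  rw [matchingCost_eq_paddedCost le_rfl le_rfl]
  exact (paddedCost_le n x y 1).trans_eq (by simp [padPoints])

end MatchingCost

section D1

variable {S : Type*} [MeasurableSpace S] [MetricSpace (Option S)]

theorem D1_nonneg (μ ν : CountingMeasure S) : 0 ≤ D1 μ ν := matchingCost_nonneg _ _

theorem D1_comm (μ ν : CountingMeasure S) : D1 μ ν = D1 ν μ := matchingCost_comm _ _

theorem D1_triangle (μ ν κ : CountingMeasure S) : D1 μ κ ≤ D1 μ ν + D1 ν κ :=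
  matchingCost_triangle _ _ _

theorem D1_le_mul_max {R : ℝ} (hR : ∀ a b : Option S, dist a b ≤ R) (μ ν : CountingMeasure S) :
    D1 μ ν ≤ R * max (μ.size : ℝ) ν.size := by
  exact (matchingCost_le_mul_max hR μ.points ν.points).trans_eq (by simp)

end D1

/-- The counting measure `δ_{x₁} + ⋯ + δ_{x_n}`. -/
noncomputable def sumDirac {S : Type*} [MeasurableSpace S] {n : ℕ} (x : Fin n → S) :
    CountingMeasure S :=
  ⟨∑ i, Measure.dirac (x i), n, x, rfl⟩

/-! ### The `σ`-algebra generated by the point counts -/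

namespace CountingMeasure

variable {S : Type*} [MeasurableSpace S]

theorem sumDirac_points (μ : CountingMeasure S) : sumDirac μ.points = μ :=
  Subtype.ext (eq_sum_dirac μ).symm

theorem sumDirac_apply [MeasurableSingletonClass S] {n : ℕ} (x : Fin n → S) {B : Set S}
    (hB : MeasurableSet B) [DecidablePred (x · ∈ B)] :
    (sumDirac x : Measure S) B = (Finset.univ.filter (x · ∈ B)).card := by
  classical
  simp [sumDirac, Measure.finsetSum_apply, Measure.dirac_apply' _ hB, Set.indicator_apply,
    Finset.sum_boole]

theorem apply_eq_card_points [MeasurableSingletonClass S] (μ : CountingMeasure S) {B : Set S}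
    (hB : MeasurableSet B) [DecidablePred (μ.points · ∈ B)] :
    (μ : Measure S) B = (Finset.univ.filter (μ.points · ∈ B)).card := by
  rw [← sumDirac_apply μ.points hB, sumDirac_points]

theorem measurable_apply {B : Set S} (hB : MeasurableSet B) :
    Measurable fun μ : CountingMeasure S => (μ : Measure S) B :=
  (Measure.measurable_coe hB).comp measurable_subtype_coe

theorem measurable_size : Measurable (size : CountingMeasure S → ℕ) := by
  refine measurable_to_countable' fun k => ?_
  have : size ⁻¹' {k} = {μ : CountingMeasure S | (μ : Measure S) Set.univ = k} := by
    ext μ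
    simp [← size_eq_mass]
  rw [this]
  exact measurable_apply .univ (measurableSet_singleton _)

/-- A counting measure lives on a finite set `F`. Any other with the same total mass and the same
masses at the points of `F` has nothing left outside `F`, so finitely many counts single it out. -/
instance [MeasurableSingletonClass S] : MeasurableSingletonClass (CountingMeasure S) where
  measurableSet_singleton μ := by
    classical
    let F : Finset S := Finset.univ.image μ.points
    have hF : (μ : Measure S) (F : Set S)ᶜ = 0 := by
      rw [apply_eq_card_points μ F.measurableSet.compl]
      simp [F]
    have : ({μ} : Set (CountingMeasure S)) =
        {ν : CountingMeasure S | (ν : Measure S) Set.univ = (μ : Measure S) Set.univ} ∩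
          ⋂ a ∈ F, {ν : CountingMeasure S | (ν : Measure S) {a} = (μ : Measure S) {a}} := by
      ext ν
      simp only [Set.mem_singleton_iff, Set.mem_inter_iff, Set.mem_ofPred_eq, Set.mem_iInter]
      refine ⟨fun h => by simp [h], fun ⟨h₀, h₁⟩ => ?_⟩
      have hsub : ∀ G ⊆ F, (ν : Measure S) G = (μ : Measure S) G := by
        intro G hG
        rw [← sum_measure_singleton, ← sum_measure_singleton]
        exact Finset.sum_congr rfl fun a ha => h₁ a (hG ha)
      have hfin : ∀ κ : CountingMeasure S, IsFiniteMeasure (κ : Measure S) := fun κ =>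
        ⟨by rw [← size_eq_mass]; exact ENNReal.natCast_lt_top _⟩
      have := hfin ν
      have := hfin μ
      have hFν : (ν : Measure S) (F : Set S)ᶜ = 0 := by
        rw [measure_compl F.measurableSet (measure_ne_top _ _), h₀, hsub F subset_rfl,
          ← measure_compl F.measurableSet (measure_ne_top _ _), hF]
      refine Subtype.ext (Measure.ext fun B hB => ?_)
      have hB' : B ∩ F = (F.filter (· ∈ B) : Finset S) := by ext; simp [and_comm]
      rw [← measure_inter_add_sdiff B F.measurableSet,
        ← measure_inter_add_sdiff (μ := (μ : Measure S)) B F.measurableSet,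
        measure_mono_null (s := B \ F) (fun x hx => hx.2) hF,
        measure_mono_null (s := B \ F) (fun x hx => hx.2) hFν, hB',
        hsub _ (Finset.filter_subset _ _)]
    rw [this]
    exact (measurable_apply .univ (measurableSet_singleton _)).inter
      (Finset.measurableSet_biInter _ fun a _ =>
        measurable_apply (measurableSet_singleton a) (measurableSet_singleton _))

/-- By Hall's theorem, a counting measure of total mass `k` has an enumeration of its points in a
given box if and only if it gives sufficient mass to the unions of the sides of the box. -/
theorem exists_sumDirac_mem_box_iff [MeasurableSingletonClass S] {k : ℕ} {b : Fin k → Set S}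
    (hb : ∀ i, MeasurableSet (b i)) (μ : CountingMeasure S) :
    (∃ x : Fin k → S, (∀ i, x i ∈ b i) ∧ sumDirac x = μ) ↔
      (μ : Measure S) Set.univ = k ∧
        ∀ J : Finset (Fin k), (J.card : ℝ≥0∞) ≤ (μ : Measure S) (⋃ j ∈ J, b j) := by
  classical
  constructor
  · rintro ⟨x, hx, rfl⟩
    refine ⟨by simp [sumDirac_apply x .univ], fun J => ?_⟩
    rw [sumDirac_apply x (J.measurableSet_biUnion fun i _ => hb i)]
    refine Nat.cast_le.2 (Finset.card_le_card fun j hj => ?_)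
    simpa using ⟨j, hj, hx j⟩
  · rintro ⟨hk, hJ⟩
    rw [← size_eq_mass, Nat.cast_inj] at hk
    subst hk
    -- Each side of the box is assigned a point of `μ` lying in it. As there are as many sides as
    -- points, the injective assignment is a permutation and gives an enumeration.
    obtain ⟨f, hf, hfb⟩ := (Finset.all_card_le_biUnion_card_iff_exists_injective
      fun j => Finset.univ.filter fun i => μ.points i ∈ b j).1 fun J => by
        have := hJ J
        rw [apply_eq_card_points μ (J.measurableSet_biUnion fun i _ => hb i),
          Nat.cast_le] at this
        refine this.trans (Finset.card_le_card fun i => ?_)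
        simp
    refine ⟨fun j => μ.points (f j), fun j => by simpa using hfb j, ?_⟩
    conv_rhs => rw [← sumDirac_points μ]
    exact Subtype.ext (Equiv.sum_comp (Equiv.ofBijective f (Finite.injective_iff_bijective.1 hf))
      fun i => Measure.dirac (μ.points i))

/-- Images commute with unions and an open set is a countable union of basic boxes, so only boxes
matter. There the Hall criterion consists of finitely many conditions on counts. -/
theorem measurableSet_image_sumDirac [TopologicalSpace S] [SecondCountableTopology S] [T1Space S]
    [BorelSpace S] {k : ℕ} {U : Set (Fin k → S)} (hU : IsOpen U) :
    MeasurableSet (sumDirac '' U) := by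
  let I := {b : Fin k → TopologicalSpace.countableBasis S //
    Set.univ.pi (fun i => (b i : Set S)) ⊆ U}
  have hopen : ∀ (b : I) (i : Fin k), IsOpen (b.1 i : Set S) := fun b i =>
    TopologicalSpace.isOpen_of_mem_countableBasis (b.1 i).2
  have hUI : U = ⋃ b : I, Set.univ.pi (fun i => (b.1 i : Set S)) := by
    refine subset_antisymm (fun x hx => ?_) (Set.iUnion_subset fun b => b.2)
    obtain ⟨u, hu, huU⟩ := isOpen_pi_iff'.1 hU x hx
    have : ∀ i, ∃ v ∈ TopologicalSpace.countableBasis S, x i ∈ v ∧ v ⊆ u i := fun i =>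
      (TopologicalSpace.isBasis_countableBasis S).exists_subset_of_mem_open (hu i).2 (hu i).1
    choose v hv hxv hvu using this
    refine Set.mem_iUnion.2 ⟨⟨fun i => ⟨v i, hv i⟩, ?_⟩, fun i _ => hxv i⟩
    exact (Set.pi_mono fun i _ => hvu i).trans huU
  rw [hUI, Set.image_iUnion]
  have : Countable I := Subtype.countable
  refine MeasurableSet.iUnion fun b => ?_
  have hmeas : ∀ i : Fin k, MeasurableSet (b.1 i : Set S) := fun i => (hopen b i).measurableSet
  have : sumDirac '' Set.univ.pi (fun i => (b.1 i : Set S)) =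
      {μ : CountingMeasure S | (μ : Measure S) Set.univ = k} ∩
        ⋂ J : Finset (Fin k),
          {μ | (J.card : ℝ≥0∞) ≤ (μ : Measure S) (⋃ j ∈ J, (b.1 j : Set S))} := by
    ext μ
    simpa using exists_sumDirac_mem_box_iff hmeas μ
  rw [this]
  exact (measurable_apply .univ (measurableSet_singleton _)).inter
    (MeasurableSet.iInter fun J =>
      measurable_apply (J.measurableSet_biUnion fun i _ => hmeas i) measurableSet_Ici)

end CountingMeasure

open CountingMeasure

/-! ### Measurability and separability of `D₁` -/

section D1

variable {S : Type*} [MetricSpace S] [TopologicalSpace.SeparableSpace S] [MeasurableSpace S]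
  [BorelSpace S] [MetricSpace (Option S)]

theorem D1_sumDirac_le {k : ℕ} (hext : Isometry (some : S → Option S)) (x y : Fin k → S) :
    D1 (sumDirac x) (sumDirac y) ≤ ∑ i, dist (x i) (y i) :=
  (D1_eq x y).trans_le
    ((matchingCost_le_sum_dist x y).trans_eq (by simp only [hext.dist_eq]))

/-- The minimum is below `r` exactly when some matching costs less than `r`, an open condition on
the enumerated points. Sublevel sets are therefore countable unions of images of open sets. -/
theorem measurable_D1_left (hext : Isometry (some : S → Option S)) (ν : CountingMeasure S) :
    Measurable fun μ : CountingMeasure S => D1 μ ν := by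
  have : SecondCountableTopology S := UniformSpace.secondCountable_of_separable S
  refine measurable_of_Iio fun r => ?_
  have : (fun μ : CountingMeasure S => D1 μ ν) ⁻¹' Set.Iio r =
      ⋃ k : ℕ, sumDirac '' ⋃ π : Equiv.Perm (Fin (max k ν.size)), {x : Fin k → S |
        ∑ i, dist (padPoints (max k ν.size) x i)
          (padPoints (max k ν.size) ν.points (π i)) < r} := by
    ext μ
    simp only [Set.mem_preimage, Set.mem_Iio, Set.mem_iUnion, Set.mem_image, Set.mem_ofPred_eq]
    constructor
    · intro h
      obtain ⟨π, hπ⟩ := exists_paddedCost_eq (max μ.size ν.size) μ.points ν.points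
      exact ⟨μ.size, μ.points, ⟨π, hπ.trans_lt h⟩, sumDirac_points μ⟩
    · rintro ⟨k, x, ⟨π, hπ⟩, rfl⟩
      rw [← sumDirac_points ν]
      refine (D1_eq x ν.points).trans_lt (lt_of_le_of_lt ?_ hπ)
      exact paddedCost_le _ x ν.points π
  rw [this]
  refine MeasurableSet.iUnion fun k => measurableSet_image_sumDirac
    (isOpen_iUnion fun π => isOpen_lt (continuous_finsetSum _ fun i _ => ?_) continuous_const)
  refine Continuous.dist ?_ continuous_const
  unfold padPoints
  split_ifs with h
  · exact hext.continuous.comp (continuous_apply _)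
  · exact continuous_const

/-- A countable family of counting measures that is dense for `D₁`. -/
theorem exists_seq_D1_lt [Nonempty S] (hext : Isometry (some : S → Option S)) :
    ∃ u : (Σ k : ℕ, Fin k → ℕ) → CountingMeasure S,
      ∀ μ : CountingMeasure S, ∀ ε : ℝ, 0 < ε → ∃ j, D1 μ (u j) < ε := by
  refine ⟨fun j => sumDirac fun i => TopologicalSpace.denseSeq S (j.2 i), fun μ ε hε => ?_⟩
  have : ∀ i, ∃ m, dist (μ.points i) (TopologicalSpace.denseSeq S m) < ε / (μ.size + 1) :=
    fun i => by
      simpa using (TopologicalSpace.denseRange_denseSeq S).exists_dist_lt (μ.points i)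
        (show 0 < ε / (μ.size + 1) by positivity)
  choose f hf using this
  refine ⟨⟨μ.size, f⟩, ?_⟩
  have h := D1_sumDirac_le hext μ.points fun i => TopologicalSpace.denseSeq S (f i)
  rw [sumDirac_points] at h
  refine h.trans_lt ((Finset.sum_le_sum fun i _ => (hf i).le).trans_lt ?_)
  rw [Finset.sum_const, Finset.card_univ, Fintype.card_fin, nsmul_eq_mul, mul_div_assoc',
    div_lt_iff₀ (by positivity)]
  nlinarith

/-- Joint measurability follows from that in one variable, because `D₁(μ, ν)` is the infimum of
`D₁(μ, u_j) + D₁(ν, u_j)` over a countable dense family. -/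
theorem measurable_ofReal_D1 [Nonempty S] (hext : Isometry (some : S → Option S)) :
    Measurable fun z : CountingMeasure S × CountingMeasure S => ENNReal.ofReal (D1 z.1 z.2) := by
  obtain ⟨u, hu⟩ := exists_seq_D1_lt hext
  have : (fun z : CountingMeasure S × CountingMeasure S => ENNReal.ofReal (D1 z.1 z.2)) =
      fun z => ⨅ j, ENNReal.ofReal (D1 z.1 (u j) + D1 z.2 (u j)) := by
    ext z
    refine le_antisymm (le_iInf fun j => ENNReal.ofReal_le_ofReal ?_) ?_
    · rw [D1_comm z.2]
      exact D1_triangle _ _ _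
    · refine ENNReal.le_of_forall_pos_le_add fun ε hε _ => ?_
      obtain ⟨j, hj⟩ := hu z.2 (ε / 2) (by positivity)
      refine (iInf_le _ j).trans ?_
      rw [← ENNReal.ofReal_coe_nnreal, ← ENNReal.ofReal_add (D1_nonneg z.1 z.2) ε.coe_nonneg]
      refine ENNReal.ofReal_le_ofReal ?_
      have := D1_triangle z.1 z.2 (u j)
      linarith
  rw [this]
  exact Measurable.iInf fun j => (((measurable_D1_left hext (u j)).comp measurable_fst).add
    ((measurable_D1_left hext (u j)).comp measurable_snd)).ennreal_ofReal

end D1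

/-! ### Lifting couplings of an empirical measure to the index set -/

section Coupling

variable {X : Type*} [MeasurableSpace X] {n : ℕ}

theorem lintegral_fst_eq_sum {M : Measure (Fin n × X)}
    (hM : ∀ i, M (Prod.fst ⁻¹' {i}) = (n : ℝ≥0∞)⁻¹) (f : Fin n → ℝ≥0∞) :
    ∫⁻ z, f z.1 ∂M = (n : ℝ≥0∞)⁻¹ * ∑ i, f i := by
  rw [← lintegral_map (Measurable.of_discrete (f := f)) measurable_fst, lintegral_fintype,
    Finset.mul_sum]
  refine Finset.sum_congr rfl fun i _ => ?_
  rw [Measure.map_apply measurable_fst (measurableSet_singleton i), hM, mul_comm]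

/-- A measure on `X × X` whose first marginal is the empirical measure of `x` lifts to a measure
on `Fin n × X` whose first marginal is uniform. -/
theorem exists_lift_of_map_fst_eq [MeasurableSingletonClass X] (hn : n ≠ 0) (x : Fin n → X)
    {γ : Measure (X × X)}
    (hγ : γ.map Prod.fst = (n : ℝ≥0∞)⁻¹ • ∑ i, Measure.dirac (x i)) :
    ∃ M : Measure (Fin n × X), (∀ i, M (Prod.fst ⁻¹' {i}) = (n : ℝ≥0∞)⁻¹) ∧
      M.map Prod.snd = γ.map Prod.snd ∧
      ∀ g : X × X → ℝ≥0∞, Measurable g → ∫⁻ z, g (x z.1, z.2) ∂M = ∫⁻ z, g z ∂γ := by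
  classical
  let w : X → ℝ≥0∞ := fun a => γ (Prod.fst ⁻¹' {a})
  have hw : ∀ a, w a = (n : ℝ≥0∞)⁻¹ * ∑ i, if x i = a then 1 else 0 := by
    intro a
    have := congrArg (fun ν : Measure X => ν {a}) hγ
    simp only [Measure.map_apply measurable_fst (measurableSet_singleton a)] at this
    simp only [w, this, Measure.smul_apply, Measure.finsetSum_apply, smul_eq_mul]
    simp [Set.indicator_apply]
  have hn0 : (n : ℝ≥0∞)⁻¹ ≠ 0 := by simp
  have hnt : (n : ℝ≥0∞)⁻¹ ≠ ∞ := by simpa using hn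
  have hw0 : ∀ i, w (x i) ≠ 0 := by
    intro i
    rw [hw]
    refine mul_ne_zero hn0 fun h => ?_
    simpa using Finset.sum_eq_zero_iff.1 h i (Finset.mem_univ i)
  have hwt : ∀ a, w a ≠ ∞ := by
    intro a
    rw [hw]
    refine ENNReal.mul_ne_top hnt (ENNReal.sum_ne_top.2 fun i _ => ?_)
    split_ifs <;> simp
  -- Sample points may coincide: the slice of `γ` over `x i` has mass (multiplicity)`/n`, and this
  -- weight divides it equally among the indices sharing that point.
  let c : Fin n → ℝ≥0∞ := fun i => (n : ℝ≥0∞)⁻¹ * (w (x i))⁻¹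
  have hpair : ∀ i : Fin n, Measurable fun z : X × X => (i, z.2) := fun i => by fun_prop
  have hset : ∀ a : X, MeasurableSet (Prod.fst ⁻¹' {a} : Set (X × X)) := fun a =>
    measurable_fst (measurableSet_singleton a)
  let M : Measure (Fin n × X) :=
    ∑ i, c i • (γ.restrict (Prod.fst ⁻¹' {x i})).map fun z => (i, z.2)
  have hrange : ∀ᵐ z ∂γ, z.1 ∈ Set.range x := by
    have hm : MeasurableSet (Set.range x) := (Set.finite_range x).measurableSet
    have : ∀ᵐ a ∂(γ.map Prod.fst), a ∈ Set.range x := by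
      rw [hγ, ae_iff]
      simp only [Measure.smul_apply, Measure.finsetSum_apply, smul_eq_mul]
      refine mul_eq_zero_of_right _ (Finset.sum_eq_zero fun i _ => ?_)
      rw [Measure.dirac_apply]
      simp
    exact ae_of_ae_map measurable_fst.aemeasurable this
  have hint : ∀ g : X × X → ℝ≥0∞, Measurable g →
      ∫⁻ z, g (x z.1, z.2) ∂M = ∫⁻ z, g z ∂γ := by
    intro g hg
    have hgm : Measurable fun z : Fin n × X => g (x z.1, z.2) :=
      hg.comp ((Measurable.of_discrete.comp measurable_fst).prodMk measurable_snd)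
    have h₁ : ∀ i, ∫⁻ z, g (x z.1, z.2) ∂(c i • (γ.restrict (Prod.fst ⁻¹' {x i})).map
        fun z => (i, z.2)) =
          ∫⁻ z, c i * (Prod.fst ⁻¹' {x i}).indicator g z ∂γ := by
      intro i
      rw [lintegral_smul_measure, lintegral_map hgm (hpair i),
        lintegral_const_mul _ (hg.indicator (hset _)), lintegral_indicator (hset _), smul_eq_mul]
      congr 1
      refine setLIntegral_congr_fun (hset _) fun z hz => ?_
      rw [← (hz : z.1 = x i)]
    simp only [M, lintegral_finsetSum_measure, h₁]
    rw [← lintegral_finsetSum _ fun i _ => (hg.indicator (hset _)).const_mul _]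
    refine lintegral_congr_ae (hrange.mono fun z hz => ?_)
    obtain ⟨j, hj⟩ := hz
    have h₂ : ∀ i, c i * (Prod.fst ⁻¹' {x i}).indicator g z =
        (w (x j))⁻¹ * g z * ((n : ℝ≥0∞)⁻¹ * if x i = x j then 1 else 0) := by
      intro i
      simp only [Set.indicator_apply, Set.mem_preimage, Set.mem_singleton_iff, ← hj, c]
      by_cases h : x i = x j
      · simp [h]; ring
      · simp [h, Ne.symm h]
    simp only [h₂]
    rw [← Finset.mul_sum, ← Finset.mul_sum, ← hw, mul_right_comm,
      ENNReal.inv_mul_cancel (hw0 j) (hwt _), one_mul]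
  refine ⟨M, fun i => ?_, ?_, hint⟩
  · have h₁ : ∀ j, ((γ.restrict (Prod.fst ⁻¹' {x j})).map fun z => (j, z.2))
        (Prod.fst ⁻¹' {i} : Set (Fin n × X)) = if j = i then w (x i) else 0 := by
      intro j
      rw [Measure.map_apply (hpair j) (measurable_fst (measurableSet_singleton i))]
      by_cases h : j = i
      · subst h
        simp [Set.preimage_preimage, w]
      · simp [Set.preimage_preimage, h]
    simp only [M, Measure.finsetSum_apply, Measure.smul_apply, h₁, smul_eq_mul]
    simp only [mul_ite, mul_zero, Finset.sum_ite_eq', Finset.mem_univ, if_true, c]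
    rw [mul_assoc, ENNReal.inv_mul_cancel (hw0 i) (hwt _), mul_one]
  · ext B hB
    have hBm : Measurable fun z : X × X => B.indicator (1 : X → ℝ≥0∞) z.2 :=
      (measurable_one.indicator hB).comp measurable_snd
    have := hint _ hBm
    rw [Measure.map_apply measurable_snd hB, Measure.map_apply measurable_snd hB,
      ← lintegral_indicator_one (measurable_snd hB), ← lintegral_indicator_one (measurable_snd hB)]
    exact this

end Coupling

/-! ### Finiteness of the Wasserstein distance -/

section Wasserstein

variable {S : Type*} [MeasurableSpace S] [MetricSpace (Option S)] {p : ℝ}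

theorem wassersteinDist_le_of_mem_couplings (hp : 1 ≤ p) {Q₁ Q₂ : Measure (CountingMeasure S)}
    {γ : Measure (CountingMeasure S × CountingMeasure S)} (hγ : γ ∈ couplings Q₁ Q₂) :
    wassersteinDist p Q₁ Q₂ ≤ (∫⁻ z, ENNReal.ofReal (D1 z.1 z.2) ^ p ∂γ) ^ (1 / p) :=
  ENNReal.rpow_le_rpow (iInf₂_le γ hγ) (by positivity)

/-- The product coupling already has finite cost: `D₁ ^ p` is bounded by a constant times a product
of exponentials of the two sizes, by `u + 1 ≤ e^u` with `u = s(|μ| + |ν|)/p`. -/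
theorem wassersteinDist_ne_top {Q₁ Q₂ : Measure (CountingMeasure S)} [IsProbabilityMeasure Q₁]
    [IsProbabilityMeasure Q₂] {R : ℝ} (hR₀ : 0 ≤ R) (hR : ∀ a b : Option S, dist a b ≤ R)
    (hp : 1 ≤ p) {s : ℝ} (hs : 0 < s)
    (h₁ : ∫⁻ μ, ENNReal.ofReal (Real.exp (s * μ.size)) ∂Q₁ ≠ ∞)
    (h₂ : ∫⁻ μ, ENNReal.ofReal (Real.exp (s * μ.size)) ∂Q₂ ≠ ∞) :
    wassersteinDist p Q₁ Q₂ ≠ ∞ := by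
  have hp₀ : 0 < p := by positivity
  have hmem : Q₁.prod Q₂ ∈ couplings Q₁ Q₂ :=
    ⟨by simp [Measure.map_fst_prod], by simp [Measure.map_snd_prod]⟩
  have hm : Measurable fun μ : CountingMeasure S =>
      ENNReal.ofReal (Real.exp (s * (μ.size : ℝ))) := by
    have : Measurable fun μ : CountingMeasure S => (μ.size : ℝ) :=
      measurable_from_nat.comp measurable_size
    exact (Real.measurable_exp.comp (this.const_mul s)).ennreal_ofReal
  have hbound : ∀ μ ν : CountingMeasure S, ENNReal.ofReal (D1 μ ν) ^ p ≤
      ENNReal.ofReal ((R * (p / s)) ^ p) *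
        (ENNReal.ofReal (Real.exp (s * μ.size)) * ENNReal.ofReal (Real.exp (s * ν.size))) := by
    intro μ ν
    rw [ENNReal.ofReal_rpow_of_nonneg (D1_nonneg _ _) hp₀.le,
      ← ENNReal.ofReal_mul (Real.exp_pos _).le, ← Real.exp_add,
      ← ENNReal.ofReal_mul (by positivity)]
    refine ENNReal.ofReal_le_ofReal ?_
    have e₁ : D1 μ ν ≤ R * (p / s) * Real.exp ((s * μ.size + s * ν.size) / p) := by
      refine (D1_le_mul_max hR μ ν).trans ?_
      rw [mul_assoc]
      refine mul_le_mul_of_nonneg_left ?_ hR₀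
      have e₂ := Real.add_one_le_exp ((s * μ.size + s * ν.size) / p)
      have e₃ : max (μ.size : ℝ) ν.size ≤ μ.size + ν.size :=
        max_le_add_of_nonneg (by positivity) (by positivity)
      refine e₃.trans ?_
      have e₄ : (μ.size : ℝ) + ν.size = p / s * ((s * μ.size + s * ν.size) / p) := by
        field_simp
      rw [e₄]
      exact mul_le_mul_of_nonneg_left (by linarith) (by positivity)
    refine (Real.rpow_le_rpow (D1_nonneg _ _) e₁ hp₀.le).trans_eq ?_
    rw [Real.mul_rpow (by positivity) (by positivity), ← Real.exp_mul,
      div_mul_cancel₀ _ hp₀.ne']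
  have hfin : ∫⁻ z, ENNReal.ofReal (D1 z.1 z.2) ^ p ∂(Q₁.prod Q₂) ≠ ∞ := by
    refine ne_top_of_le_ne_top ?_ (lintegral_mono fun z => hbound z.1 z.2)
    rw [lintegral_const_mul' _ _ ENNReal.ofReal_ne_top,
      lintegral_prod_mul hm.aemeasurable hm.aemeasurable]
    exact ENNReal.mul_ne_top ENNReal.ofReal_ne_top (ENNReal.mul_ne_top h₁ h₂)
  exact ne_top_of_le_ne_top (ENNReal.rpow_ne_top_of_nonneg (by positivity) hfin)
    (ENNReal.rpow_le_rpow (iInf₂_le _ hmem) (by positivity))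

end Wasserstein

/-! ### Dependence of the Wasserstein distance on the sample -/

section EmpiricalMeasure

variable {S : Type*} [MetricSpace S] [TopologicalSpace.SeparableSpace S] [MeasurableSpace S]
  [BorelSpace S] [Nonempty S] [MetricSpace (Option S)] {n : ℕ} {p : ℝ}
  {Q : Measure (CountingMeasure S)}

theorem wassersteinDist_empiricalMeasure_le (hext : Isometry (some : S → Option S)) (hp : 1 ≤ p)
    (μ : Fin n → CountingMeasure S) {M : Measure (Fin n × CountingMeasure S)}
    (hM : ∀ i, M (Prod.fst ⁻¹' {i}) = (n : ℝ≥0∞)⁻¹) (hMQ : M.map Prod.snd = Q) :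
    wassersteinDist p (empiricalMeasure μ) Q ≤
      (∫⁻ z, ENNReal.ofReal (D1 (μ z.1) z.2) ^ p ∂M) ^ (1 / p) := by
  have hφ : Measurable fun z : Fin n × CountingMeasure S => (μ z.1, z.2) :=
    (Measurable.of_discrete.comp measurable_fst).prodMk measurable_snd
  have hD := (measurable_ofReal_D1 hext).pow_const p
  rw [← lintegral_map hD hφ]
  refine wassersteinDist_le_of_mem_couplings hp ⟨?_, ?_⟩
  · rw [Measure.map_map measurable_fst hφ]
    ext B hB
    rw [Measure.map_apply (measurable_fst.comp hφ) hB,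
      ← lintegral_indicator_one ((measurable_fst.comp hφ) hB)]
    refine (lintegral_fst_eq_sum hM fun i => B.indicator (1 : CountingMeasure S → ℝ≥0∞) (μ i)).trans ?_
    simp only [empiricalMeasure, Measure.smul_apply, Measure.finsetSum_apply, smul_eq_mul,
      Measure.dirac_apply' _ hB]
  · rw [Measure.map_map measurable_snd hφ]
    exact hMQ

/-- The Wasserstein distance to a fixed measure is Lipschitz in the sample. -/
theorem wassersteinDist_empiricalMeasure_le_add (hext : Isometry (some : S → Option S))
    (hp : 1 ≤ p) (hn : n ≠ 0) (μ μ' : Fin n → CountingMeasure S) :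
    wassersteinDist p (empiricalMeasure μ) Q ≤ wassersteinDist p (empiricalMeasure μ') Q +
      ((n : ℝ≥0∞)⁻¹ * ∑ i, ENNReal.ofReal (D1 (μ i) (μ' i)) ^ p) ^ (1 / p) := by
  have hp₀ : 0 < 1 / p := by positivity
  have hD := measurable_ofReal_D1 hext
  have key : ∀ γ ∈ couplings (empiricalMeasure μ') Q,
      wassersteinDist p (empiricalMeasure μ) Q ≤
        (∫⁻ z, ENNReal.ofReal (D1 z.1 z.2) ^ p ∂γ) ^ (1 / p) +
          ((n : ℝ≥0∞)⁻¹ * ∑ i, ENNReal.ofReal (D1 (μ i) (μ' i)) ^ p) ^ (1 / p) := by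
    rintro γ ⟨hγ₁, hγ₂⟩
    -- A measure on indices serves both samples: `M` reproduces the cost of `γ` for `μ'` and yields
    -- a coupling for `μ`. The two costs are compared by Minkowski's inequality in `L^p(M)`.
    obtain ⟨M, hM, hMγ, hMint⟩ := exists_lift_of_map_fst_eq hn μ' hγ₁
    refine (wassersteinDist_empiricalMeasure_le hext hp μ hM (hMγ.trans hγ₂)).trans ?_
    rw [← hMint (fun z => ENNReal.ofReal (D1 z.1 z.2) ^ p) (hD.pow_const p),
      ← lintegral_fst_eq_sum hM fun i => ENNReal.ofReal (D1 (μ i) (μ' i)) ^ p, add_comm]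
    have hm₁ : Measurable fun z : Fin n × CountingMeasure S =>
        ENNReal.ofReal (D1 (μ z.1) (μ' z.1)) :=
      (Measurable.of_discrete (f := fun i => ENNReal.ofReal (D1 (μ i) (μ' i)))).comp measurable_fst
    have hφ : Measurable fun z : Fin n × CountingMeasure S => (μ' z.1, z.2) :=
      (Measurable.of_discrete.comp measurable_fst).prodMk measurable_snd
    have hm₂ : Measurable fun z : Fin n × CountingMeasure S => ENNReal.ofReal (D1 (μ' z.1) z.2) := by
      simpa only [Function.comp_def] using hD.comp hφ
    have hadd := ENNReal.lintegral_Lp_add_le (μ := M) hm₁.aemeasurable hm₂.aemeasurable hp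
    refine le_trans ?_ hadd
    refine ENNReal.rpow_le_rpow (lintegral_mono fun z => ENNReal.rpow_le_rpow ?_ ?_) hp₀.le
    swap
    · positivity
    rw [Pi.add_apply, ← ENNReal.ofReal_add (D1_nonneg _ _) (D1_nonneg _ _)]
    exact ENNReal.ofReal_le_ofReal (D1_triangle _ _ _)
  have hW : wassersteinDist p (empiricalMeasure μ') Q =
      ⨅ γ ∈ couplings (empiricalMeasure μ') Q,
        (∫⁻ z, ENNReal.ofReal (D1 z.1 z.2) ^ p ∂γ) ^ (1 / p) := by
    have h := fun γ => (ENNReal.orderIsoRpow (1 / p) hp₀).map_iInf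
      fun _ : γ ∈ couplings (empiricalMeasure μ') Q =>
        ∫⁻ z, ENNReal.ofReal (D1 z.1 z.2) ^ p ∂γ
    simp only [ENNReal.orderIsoRpow_apply] at h
    simp only [← h]
    exact (ENNReal.orderIsoRpow (1 / p) hp₀).map_iInf _
  rw [hW, ENNReal.iInf_add]
  refine le_iInf fun γ => ?_
  rw [ENNReal.iInf_add]
  exact le_iInf fun hγ => key γ hγ

/-- A `p`-mean is at most the sum. This crude form is enough for measurability. -/
theorem wassersteinDist_empiricalMeasure_le_add_sum (hext : Isometry (some : S → Option S))
    (hp : 1 ≤ p) (hn : n ≠ 0) (μ μ' : Fin n → CountingMeasure S) :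
    wassersteinDist p (empiricalMeasure μ) Q ≤ wassersteinDist p (empiricalMeasure μ') Q +
      ∑ i, ENNReal.ofReal (D1 (μ i) (μ' i)) := by
  refine (wassersteinDist_empiricalMeasure_le_add hext hp hn μ μ').trans (add_le_add_right ?_ _)
  have hp₀ : 0 < p := by positivity
  rw [one_div, ENNReal.rpow_inv_le_iff hp₀]
  have : ∀ i, ENNReal.ofReal (D1 (μ i) (μ' i)) ^ p ≤
      (∑ j, ENNReal.ofReal (D1 (μ j) (μ' j))) ^ p := fun i =>
    ENNReal.rpow_le_rpow (Finset.single_le_sum (f := fun j => ENNReal.ofReal (D1 (μ j) (μ' j)))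
      (fun _ _ => zero_le) (Finset.mem_univ i)) hp₀.le
  refine (mul_le_mul_right (Finset.sum_le_sum fun i _ => this i) _).trans_eq ?_
  rw [Finset.sum_const, Finset.card_univ, Fintype.card_fin, nsmul_eq_mul, ← mul_assoc,
    ENNReal.inv_mul_cancel (by simpa using hn) (ENNReal.natCast_ne_top n), one_mul]

/-- Only the `i`-th term of the average survives, and its weight `1/n` becomes `n^(-1/p)` under the
root. The disjunction covers both directions of the later bound on the absolute difference. -/
theorem wassersteinDist_empiricalMeasure_le_update (hext : Isometry (some : S → Option S))
    (hp : 1 ≤ p) (hn : n ≠ 0) (μ : Fin n → CountingMeasure S) (i : Fin n)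
    (ν : CountingMeasure S) {μ₁ μ₂ : Fin n → CountingMeasure S}
    (h : μ₁ = μ ∧ μ₂ = Function.update μ i ν ∨ μ₂ = μ ∧ μ₁ = Function.update μ i ν) :
    wassersteinDist p (empiricalMeasure μ₁) Q ≤ wassersteinDist p (empiricalMeasure μ₂) Q +
      ENNReal.ofReal ((n : ℝ) ^ (-1 / p) * D1 (μ i) ν) := by
  refine (wassersteinDist_empiricalMeasure_le_add hext hp hn μ₁ μ₂).trans_eq ?_
  have hp₀ : 0 < p := by positivity
  have hself : ∀ κ : CountingMeasure S, D1 κ κ = 0 := fun κ => by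
    refine le_antisymm ?_ (D1_nonneg κ κ)
    exact (matchingCost_le_sum_dist κ.points κ.points).trans_eq (by simp)
  have : ∀ j, ENNReal.ofReal (D1 (μ₁ j) (μ₂ j)) ^ p =
      if j = i then ENNReal.ofReal (D1 (μ i) ν) ^ p else 0 := by
    intro j
    by_cases hj : j = i
    · subst hj
      rcases h with ⟨rfl, rfl⟩ | ⟨rfl, rfl⟩
      · simp
      · simp [D1_comm ν]
    · rcases h with ⟨rfl, rfl⟩ | ⟨rfl, rfl⟩ <;> simp [hj, hself, hp₀]
  simp only [this, Finset.sum_ite_eq', Finset.mem_univ, if_true]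
  congr 1
  have hn' : (0 : ℝ) < n := by positivity
  rw [ENNReal.mul_rpow_of_nonneg _ _ (by positivity), ← ENNReal.rpow_mul,
    mul_one_div_cancel hp₀.ne', ENNReal.rpow_one, ENNReal.ofReal_mul (by positivity), neg_div,
    Real.rpow_neg hn'.le, ENNReal.ofReal_inv_of_pos (by positivity),
    ← ENNReal.ofReal_rpow_of_pos hn', ENNReal.ofReal_natCast, ENNReal.inv_rpow]

/-- The infimum over couplings is uncountable. A Lipschitz function is, however, recovered from its
values on a countable dense set by a countable infimum. -/
theorem measurable_wassersteinDist_empiricalMeasure (hext : Isometry (some : S → Option S))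
    (hp : 1 ≤ p) (hn : n ≠ 0) :
    Measurable fun μ : Fin n → CountingMeasure S =>
      wassersteinDist p (empiricalMeasure μ) Q := by
  obtain ⟨u, hu⟩ := exists_seq_D1_lt hext
  have : (fun μ : Fin n → CountingMeasure S => wassersteinDist p (empiricalMeasure μ) Q) =
      fun μ => ⨅ j : Fin n → Σ k : ℕ, Fin k → ℕ,
        (wassersteinDist p (empiricalMeasure fun i => u (j i)) Q +
          ∑ i, ENNReal.ofReal (D1 (μ i) (u (j i)))) := by
    ext μ
    refine le_antisymm (le_iInf fun j =>
      wassersteinDist_empiricalMeasure_le_add_sum hext hp hn μ _) ?_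
    refine ENNReal.le_of_forall_pos_le_add fun ε hε _ => ?_
    -- The distance between the samples enters twice, once in the infimum and once through the
    -- Lipschitz bound; each time it costs at most `ε / 2`.
    have hnε : 0 < (ε : ℝ) / (2 * n) := by positivity
    choose j hj using fun i => hu (μ i) _ hnε
    have hsum : ∑ i, ENNReal.ofReal (D1 (μ i) (u (j i))) ≤ ENNReal.ofReal (ε / 2) := by
      rw [← ENNReal.ofReal_sum_of_nonneg fun i _ => D1_nonneg _ _]
      refine ENNReal.ofReal_le_ofReal ((Finset.sum_le_sum fun i _ => (hj i).le).trans_eq ?_)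
      simp
      field_simp
    refine (iInf_le _ j).trans ((add_le_add_left
      (wassersteinDist_empiricalMeasure_le_add_sum hext hp hn (fun i => u (j i)) μ) _).trans ?_)
    simp only [D1_comm (u _)]
    rw [add_assoc]
    refine add_le_add_right ((add_le_add hsum hsum).trans_eq ?_) _
    rw [← ENNReal.ofReal_add (by positivity) (by positivity), add_halves,
      ENNReal.ofReal_coe_nnreal]
  rw [this]
  exact Measurable.iInf fun j => measurable_const.add (Finset.measurable_fun_sum _ fun i _ =>
    ((measurable_D1_left hext (u (j i))).comp (measurable_pi_apply i)).ennreal_ofReal)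

end EmpiricalMeasure

/-! ### Concentration for functions of independent variables with unbounded differences -/

theorem abs_sub_le_sum_of_update {X ι : Type*} [Fintype ι] [DecidableEq ι] {F : (ι → X) → ℝ}
    {h : X → ℝ} (hh₀ : ∀ x, 0 ≤ h x)
    (hF : ∀ x i y, |F x - F (Function.update x i y)| ≤ max (h (x i)) (h y)) (x x₀ : ι → X) :
    |F x - F x₀| ≤ ∑ i, (h (x i) + h (x₀ i)) := by
  have key : ∀ s : Finset ι, |F (s.piecewise x x₀) - F x₀| ≤ ∑ i ∈ s, (h (x i) + h (x₀ i)) := by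
    intro s
    induction s using Finset.induction_on with
    | empty => simp
    | insert a s ha ih =>
      rw [Finset.piecewise_insert, Finset.sum_insert ha]
      have h₁ := hF (s.piecewise x x₀) a (x a)
      rw [Finset.piecewise_eq_of_notMem _ _ _ ha, abs_sub_comm] at h₁
      have h₂ := max_le_add_of_nonneg (hh₀ (x₀ a)) (hh₀ (x a))
      have h₃ := abs_sub_le (F (Function.update (s.piecewise x x₀) a (x a)))
        (F (s.piecewise x x₀)) (F x₀)
      linarith
  simpa using key Finset.univ

section Concentration

variable {X : Type*} [MeasurableSpace X] {Q : Measure X} [IsProbabilityMeasure Q]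

/-- Jensen's inequality, in extended form so that the exponential need not be integrable. -/
theorem ofReal_exp_integral_le {u : X → ℝ} (hu : Integrable u Q) :
    ENNReal.ofReal (Real.exp (∫ x, u x ∂Q)) ≤ ∫⁻ x, ENNReal.ofReal (Real.exp (u x)) ∂Q := by
  by_cases h : ∫⁻ x, ENNReal.ofReal (Real.exp (u x)) ∂Q = ∞
  · simp [h]
  have hint : Integrable (fun x => Real.exp (u x)) Q := by
    refine ⟨(Real.measurable_exp.comp_aemeasurable hu.aemeasurable).aestronglyMeasurable, ?_⟩
    rw [hasFiniteIntegral_iff_ofReal (.of_forall fun x => (Real.exp_pos _).le)]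
    exact lt_top_iff_ne_top.2 h
  rw [← ofReal_integral_eq_lintegral_ofReal hint (.of_forall fun x => (Real.exp_pos _).le)]
  exact ENNReal.ofReal_le_ofReal (convexOn_exp.map_integral_le Real.continuous_exp.continuousOn
    isClosed_univ (.of_forall fun x => Set.mem_univ _) hu hint)

theorem integrable_of_abs_sub_le_max [Nonempty X] {g h : X → ℝ} (hg : Measurable g)
    (hh : Integrable h Q) (hh₀ : ∀ x, 0 ≤ h x)
    (hgh : ∀ x y, |g x - g y| ≤ max (h x) (h y)) : Integrable g Q := by
  obtain ⟨x₀⟩ := ‹Nonempty X›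
  refine Integrable.mono' (g := fun x => |g x₀| + h x₀ + h x)
    ((integrable_const _).add hh) hg.aestronglyMeasurable (.of_forall fun x => ?_)
  have h₁ := hgh x x₀
  have h₂ := max_le_add_of_nonneg (hh₀ x) (hh₀ x₀)
  have h₃ := abs_sub_abs_le_abs_sub (g x) (g x₀)
  rw [Real.norm_eq_abs]
  linarith

/-- A bound for the moment generating function by symmetrization. -/
theorem lintegral_exp_sub_integral_le {g h : X → ℝ} (hg : Measurable g) (hgi : Integrable g Q)
    (hh : Measurable h) (hgh : ∀ x y, |g x - g y| ≤ max (h x) (h y)) (t : ℝ) :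
    ∫⁻ x, ENNReal.ofReal (Real.exp (t * (g x - ∫ y, g y ∂Q))) ∂Q ≤
      1 + 2 * ∫⁻ x, ENNReal.ofReal (Real.cosh (t * h x) - 1) ∂Q := by
  have hm : Measurable fun z : X × X => ENNReal.ofReal (Real.exp (t * (g z.1 - g z.2))) := by
    fun_prop
  have h₁ : ∫⁻ x, ENNReal.ofReal (Real.exp (t * (g x - ∫ y, g y ∂Q))) ∂Q ≤
      ∫⁻ x, ∫⁻ y, ENNReal.ofReal (Real.exp (t * (g x - g y))) ∂Q ∂Q := by
    refine lintegral_mono fun x => ?_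
    have : t * (g x - ∫ y, g y ∂Q) = ∫ y, t * (g x - g y) ∂Q := by
      rw [integral_const_mul, integral_sub (integrable_const _) hgi]
      simp
    simp only [this]
    exact ofReal_exp_integral_le (((integrable_const _).sub hgi).const_mul t)
  refine h₁.trans ?_
  set I := ∫⁻ x, ∫⁻ y, ENNReal.ofReal (Real.exp (t * (g x - g y))) ∂Q ∂Q with hI
  set B := ∫⁻ x, ENNReal.ofReal (Real.cosh (t * h x) - 1) ∂Q with hB
  have hI' : I = ∫⁻ x, ∫⁻ y, ENNReal.ofReal (Real.exp (t * (g y - g x))) ∂Q ∂Q :=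
    lintegral_lintegral_swap hm.aemeasurable
  -- The two exponentials add up to `2 cosh`. The maximum is one of `h x`, `h y`, and the `cosh - 1`
  -- term of the other is nonnegative, so a sum of one-variable terms dominates.
  have hcosh : ∀ x y, Real.exp (t * (g x - g y)) + Real.exp (t * (g y - g x)) ≤
      2 + (2 * (Real.cosh (t * h x) - 1) + 2 * (Real.cosh (t * h y) - 1)) := by
    intro x y
    have e₁ : Real.exp (t * (g x - g y)) + Real.exp (t * (g y - g x)) =
        2 * Real.cosh (t * (g x - g y)) := by
      rw [Real.cosh_eq, show t * (g y - g x) = -(t * (g x - g y)) by ring]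
      ring
    have e₂ : Real.cosh (t * (g x - g y)) ≤ Real.cosh (t * max (h x) (h y)) := by
      rw [Real.cosh_le_cosh, abs_mul, abs_mul]
      exact mul_le_mul_of_nonneg_left ((hgh x y).trans (le_abs_self _)) (abs_nonneg t)
    have e₃ := Real.one_le_cosh (t * h x)
    have e₄ := Real.one_le_cosh (t * h y)
    rcases max_choice (h x) (h y) with h | h <;> rw [h] at e₂ <;> linarith
  have h2 : I + I ≤ (1 + 2 * B) + (1 + 2 * B) := by
    calc I + I = ∫⁻ x, ∫⁻ y, (ENNReal.ofReal (Real.exp (t * (g x - g y)))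
          + ENNReal.ofReal (Real.exp (t * (g y - g x)))) ∂Q ∂Q := by
          nth_rw 2 [hI']
          rw [hI, ← lintegral_add_left hm.lintegral_prod_right']
          refine lintegral_congr fun x => (lintegral_add_left ?_ _).symm
          fun_prop
      _ ≤ ∫⁻ x, ∫⁻ y, (2 + (2 * ENNReal.ofReal (Real.cosh (t * h x) - 1)
          + 2 * ENNReal.ofReal (Real.cosh (t * h y) - 1))) ∂Q ∂Q := by
          refine lintegral_mono fun x => lintegral_mono fun y => ?_
          have e₃ : 0 ≤ Real.cosh (t * h x) - 1 := sub_nonneg.2 (Real.one_le_cosh (t * h x))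
          have e₄ : 0 ≤ Real.cosh (t * h y) - 1 := sub_nonneg.2 (Real.one_le_cosh (t * h y))
          rw [← ENNReal.ofReal_add (Real.exp_pos _).le (Real.exp_pos _).le]
          refine (ENNReal.ofReal_le_ofReal (hcosh x y)).trans_eq ?_
          rw [ENNReal.ofReal_add (by norm_num) (by positivity),
            ENNReal.ofReal_add (by positivity) (by positivity),
            ENNReal.ofReal_mul (by norm_num), ENNReal.ofReal_mul (by norm_num)]
          simp
      _ = (1 + 2 * B) + (1 + 2 * B) := by
          have hc : Measurable fun y => ENNReal.ofReal (Real.cosh (t * h y) - 1) :=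
            ((Real.measurable_cosh.comp (hh.const_mul t)).sub_const 1).ennreal_ofReal
          simp_rw [lintegral_add_left measurable_const]
          simp only [lintegral_const, measure_univ, mul_one]
          rw [lintegral_add_right _ measurable_const, lintegral_const_mul _ hc, ← hB]
          simp only [lintegral_const, measure_univ, mul_one]
          ring
  rw [← two_mul, ← two_mul] at h2
  exact (ENNReal.mul_le_mul_iff_right (by norm_num) (by norm_num)).1 h2

theorem integrable_pi_of_update [Nonempty X] {ι : Type*} [Fintype ι] [DecidableEq ι]
    {F : (ι → X) → ℝ} {h : X → ℝ} (hFm : Measurable F) (hh : Integrable h Q) (hh₀ : ∀ x, 0 ≤ h x)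
    (hF : ∀ x i y, |F x - F (Function.update x i y)| ≤ max (h (x i)) (h y)) :
    Integrable F (Measure.pi fun _ : ι => Q) := by
  obtain ⟨x₀⟩ : Nonempty (ι → X) := inferInstance
  refine Integrable.mono' (g := fun x => |F x₀| + ∑ i, (h (x i) + h (x₀ i))) ?_
    hFm.aestronglyMeasurable (.of_forall fun x => ?_)
  · refine (integrable_const _).add (integrable_finsetSum _ fun i _ => Integrable.add ?_
      (integrable_const _))
    exact (measurePreserving_eval (fun _ : ι => Q) i).integrable_comp_of_integrable hh
  · have h₁ := abs_sub_le_sum_of_update hh₀ hF x x₀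
    have h₂ := abs_sub_abs_le_abs_sub (F x) (F x₀)
    rw [Real.norm_eq_abs]
    linarith

/-- Let `G` be the average of `F` over the first coordinate and split `F - EF = (F - G) + (G - EF)`.
With the other coordinates fixed, the first part is handled by symmetrization; the second is the
case of `n` coordinates. -/
theorem lintegral_pi_exp_sub_integral_le [Nonempty X] {h : X → ℝ} (hh : Measurable h)
    (hhi : Integrable h Q) (hh₀ : ∀ x, 0 ≤ h x) (t : ℝ) {n : ℕ}
    {F : (Fin n → X) → ℝ} (hFm : Measurable F)
    (hF : ∀ x i y, |F x - F (Function.update x i y)| ≤ max (h (x i)) (h y)) :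
    ∫⁻ x, ENNReal.ofReal (Real.exp (t * (F x - ∫ y, F y ∂Measure.pi fun _ => Q)))
        ∂(Measure.pi fun _ => Q) ≤
      (1 + 2 * ∫⁻ x, ENNReal.ofReal (Real.cosh (t * h x) - 1) ∂Q) ^ n := by
  induction n with
  | zero =>
    have hconst : ∀ x, F x = F default := fun x => congrArg F (Subsingleton.elim _ _)
    simp [hconst]
  | succ n ih =>
    let e := MeasurableEquiv.piFinSuccAbove (fun _ : Fin (n + 1) => X) 0
    have he : MeasurePreserving e.symm (Q.prod (Measure.pi fun _ : Fin n => Q))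
        (Measure.pi fun _ : Fin (n + 1) => Q) :=
      (measurePreserving_piFinSuccAbove (fun _ : Fin (n + 1) => Q) 0).symm
    have hes : ∀ x y, e.symm (x, y) = Fin.cons x y := fun x y => by
      simp [e, MeasurableEquiv.piFinSuccAbove, Fin.insertNthEquiv]
    have hFe : Measurable fun z => F (e.symm z) := hFm.comp e.symm.measurable
    have hFi : Integrable (fun z => F (e.symm z)) (Q.prod (Measure.pi fun _ : Fin n => Q)) :=
      he.integrable_comp_of_integrable (integrable_pi_of_update hFm hhi hh₀ hF)
    have hFx : ∀ y x x', |F (e.symm (x, y)) - F (e.symm (x', y))| ≤ max (h x) (h x') := by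
      intro y x x'
      simpa [hes] using hF (Fin.cons x y) 0 x'
    have hFxi : ∀ y, Integrable (fun x => F (e.symm (x, y))) Q := fun y =>
      integrable_of_abs_sub_le_max (hFe.comp measurable_prodMk_right) hhi hh₀ (hFx y)
    let G : (Fin n → X) → ℝ := fun y => ∫ x, F (e.symm (x, y)) ∂Q
    have hGm : Measurable G :=
      (hFe.stronglyMeasurable.integral_prod_left' (μ := Q)).measurable
    -- The bound does not involve the coordinate being averaged, so it passes to `G` with the same
    -- `h`.
    have hG : ∀ y i z, |G y - G (Function.update y i z)| ≤ max (h (y i)) (h z) := by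
      intro y i z
      simp only [G]
      rw [← integral_sub (hFxi _) (hFxi _)]
      refine (abs_integral_le_integral_abs).trans ?_
      refine (integral_mono ((hFxi _).sub (hFxi _)).abs (integrable_const (max (h (y i)) (h z)))
        fun x => ?_).trans_eq (by simp)
      simpa [hes, Fin.cons_update] using hF (Fin.cons x y) i.succ z
    have hint : ∫ y, F y ∂(Measure.pi fun _ : Fin (n + 1) => Q) =
        ∫ y, G y ∂(Measure.pi fun _ : Fin n => Q) := by
      rw [← he.integral_comp e.symm.measurableEmbedding, integral_prod_symm _ hFi]
    set EF := ∫ y, F y ∂(Measure.pi fun _ : Fin (n + 1) => Q) with hEF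
    set A := 1 + 2 * ∫⁻ x, ENNReal.ofReal (Real.cosh (t * h x) - 1) ∂Q with hA
    have hmeas : Measurable fun z : X × (Fin n → X) =>
        ENNReal.ofReal (Real.exp (t * (F (e.symm z) - EF))) := by fun_prop
    rw [← he.lintegral_comp_emb e.symm.measurableEmbedding, lintegral_prod_symm' _ hmeas]
    calc ∫⁻ y, ∫⁻ x, ENNReal.ofReal (Real.exp (t * (F (e.symm (x, y)) - EF))) ∂Q
          ∂(Measure.pi fun _ : Fin n => Q)
        ≤ ∫⁻ y, ENNReal.ofReal (Real.exp (t * (G y - EF))) * A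
          ∂(Measure.pi fun _ : Fin n => Q) := by
          refine lintegral_mono fun y => ?_
          refine le_trans (le_of_eq ?_) (mul_le_mul_right
            (lintegral_exp_sub_integral_le (hFe.comp measurable_prodMk_right) (hFxi y) hh
              (hFx y) t) _)
          rw [← lintegral_const_mul']
          · refine lintegral_congr fun x => ?_
            rw [← ENNReal.ofReal_mul (Real.exp_pos _).le, ← Real.exp_add]
            congr 2
            simp only [G, Function.comp_apply]
            ring
          · exact ENNReal.ofReal_ne_top
      _ = (∫⁻ y, ENNReal.ofReal (Real.exp (t * (G y - EF)))
            ∂(Measure.pi fun _ : Fin n => Q)) * A := lintegral_mul_const _ (by fun_prop)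
      _ ≤ A ^ n * A := by
          rw [hint]
          exact mul_le_mul_left (ih hGm hG) _
      _ = A ^ (n + 1) := (pow_succ _ _).symm

/-- The Chernoff bound for a function of independent variables. -/
theorem measureReal_pi_sub_integral_gt_le [Nonempty X] {h : X → ℝ} (hh : Measurable h)
    (hhi : Integrable h Q) (hh₀ : ∀ x, 0 ≤ h x) {t a : ℝ} (ht : 0 ≤ t)
    (ha : ∫⁻ x, ENNReal.ofReal (Real.cosh (t * h x) - 1) ∂Q ≤ ENNReal.ofReal a) (ha₀ : 0 ≤ a)
    {n : ℕ} {F : (Fin n → X) → ℝ} (hFm : Measurable F)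
    (hF : ∀ x i y, |F x - F (Function.update x i y)| ≤ max (h (x i)) (h y)) (ε : ℝ) :
    (Measure.pi fun _ => Q).real {x | F x - ∫ y, F y ∂(Measure.pi fun _ => Q) > ε} ≤
      Real.exp (n * (2 * a) - t * ε) := by
  have h₁ := lintegral_pi_exp_sub_integral_le hh hhi hh₀ t hFm hF
  set EF := ∫ y, F y ∂(Measure.pi fun _ => Q) with hEF
  have h₂ : (1 + 2 * ∫⁻ x, ENNReal.ofReal (Real.cosh (t * h x) - 1) ∂Q) ^ n ≤
      ENNReal.ofReal (Real.exp (n * (2 * a))) := by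
    rw [Real.exp_nat_mul, ENNReal.ofReal_pow (Real.exp_pos _).le]
    gcongr
    refine (add_le_add_right (mul_le_mul_right ha 2) 1).trans ?_
    rw [show (2 : ℝ≥0∞) = ENNReal.ofReal 2 by simp, ← ENNReal.ofReal_mul (by norm_num),
      ← ENNReal.ofReal_one, ← ENNReal.ofReal_add (by norm_num) (by positivity)]
    refine ENNReal.ofReal_le_ofReal ?_
    rw [add_comm]
    exact Real.add_one_le_exp _
  have h₃ := mul_meas_ge_le_lintegral (μ := Measure.pi fun _ => Q)
    (f := fun x => ENNReal.ofReal (Real.exp (t * (F x - EF)))) (by fun_prop)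
    (ENNReal.ofReal (Real.exp (t * ε)))
  have h₄ : {x | F x - EF > ε} ⊆ {x | ENNReal.ofReal (Real.exp (t * ε)) ≤
      ENNReal.ofReal (Real.exp (t * (F x - EF)))} := fun x hx =>
    ENNReal.ofReal_le_ofReal (Real.exp_le_exp.2 (mul_le_mul_of_nonneg_left (le_of_lt hx) ht))
  have h₅ := ((mul_le_mul_right (measure_mono h₄) _).trans h₃).trans (h₁.trans h₂)
  rw [measureReal_def, Real.exp_sub, le_div_iff₀' (Real.exp_pos _)]
  have := ENNReal.toReal_mono ENNReal.ofReal_ne_top h₅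
  rwa [ENNReal.toReal_mul, ENNReal.toReal_ofReal (Real.exp_pos _).le,
    ENNReal.toReal_ofReal (Real.exp_pos _).le] at this

end Concentration

/-! ### Exponential moments of the number of points -/

section ExponentialTail

/-- The fraction is the integral of `e^(-λx) (cosh(sx) - 1)` over the half-line. On `[i, i + 1]` the
`cosh` factor is smallest at `i`, while `e^(-λi) ≤ e^λ e^(-λx)`; this is the source of `e^λ`. -/
theorem sum_exp_mul_cosh_sub_one_le {lam s : ℝ} (hs : 0 ≤ s) (hsl : s < lam) (m : ℕ) :
    ∑ i ∈ Finset.range m, Real.exp (-lam * i) * (Real.cosh (s * i) - 1) ≤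
      Real.exp lam * (s ^ 2 / (lam * (lam ^ 2 - s ^ 2))) := by
  have hl : 0 < lam := hs.trans_lt hsl
  have h₁ : 0 < lam - s := sub_pos.2 hsl
  have h₂ : 0 < lam + s := by positivity
  -- The antiderivative of the integrand that vanishes at infinity.
  let G : ℝ → ℝ := fun x => Real.exp (-lam * x) / lam -
    Real.exp (-(lam - s) * x) / (2 * (lam - s)) - Real.exp (-(lam + s) * x) / (2 * (lam + s))
  have hG : ∀ x, HasDerivAt G (Real.exp (-lam * x) * (Real.cosh (s * x) - 1)) x := by
    intro x
    have hexp : ∀ a b : ℝ, HasDerivAt (fun y => Real.exp (-a * y) / b)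
        (Real.exp (-a * x) * -a / b) x := fun a b => by
      have := (((hasDerivAt_id x).const_mul (-a)).exp).div_const b
      simpa using this
    have := ((hexp lam lam).sub (hexp (lam - s) (2 * (lam - s)))).sub
      (hexp (lam + s) (2 * (lam + s)))
    refine HasDerivAt.congr_deriv (show HasDerivAt G _ x from this) ?_
    rw [Real.cosh_eq, show -(lam - s) * x = -lam * x + s * x by ring,
      show -(lam + s) * x = -lam * x + -(s * x) by ring, Real.exp_add, Real.exp_add]
    field_simp
    ring
  have hstep : ∀ i : ℕ, Real.exp (-lam * i) * (Real.cosh (s * i) - 1) ≤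
      Real.exp lam * (G ((i + 1 : ℕ) : ℝ) - G i) := by
    intro i
    obtain ⟨ξ, hξ, hξG⟩ := exists_hasDerivAt_eq_slope G _ (lt_add_one (i : ℝ))
      (fun x _ => (hG x).continuousAt.continuousWithinAt) fun x _ => hG x
    rw [add_sub_cancel_left, div_one] at hξG
    push_cast
    rw [← hξG, ← mul_assoc, ← Real.exp_add]
    have hi : (0 : ℝ) ≤ i := Nat.cast_nonneg i
    have hξ₀ : 0 ≤ ξ := hi.trans hξ.1.le
    refine mul_le_mul (Real.exp_le_exp.2 ?_) (sub_le_sub_right (Real.cosh_le_cosh.2 ?_) _)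
      (sub_nonneg.2 (Real.one_le_cosh _)) (Real.exp_pos _).le
    · nlinarith [hξ.2]
    · rw [abs_of_nonneg (by positivity), abs_of_nonneg (by positivity)]
      exact mul_le_mul_of_nonneg_left hξ.1.le hs
  have hGm : G m ≤ 0 := by
    -- By the arithmetic-geometric mean inequality the right side is at least `1 / √(λ² - s²)`.
    have e₁ : 1 / lam ≤ Real.exp (s * m) / (2 * (lam - s)) +
        Real.exp (-(s * m)) / (2 * (lam + s)) := by
      have hab : Real.exp (s * m) * Real.exp (-(s * m)) = 1 := by
        rw [← Real.exp_add]; simp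
      set a := Real.exp (s * m)
      set b := Real.exp (-(s * m))
      have ha : 0 < a := Real.exp_pos _
      have hb : 0 < b := Real.exp_pos _
      rw [div_add_div _ _ (by positivity) (by positivity), div_le_div_iff₀ hl (by positivity)]
      have e₂ : 0 ≤ (a * (lam + s) - b * (lam - s)) ^ 2 := sq_nonneg _
      have e₄ : 4 * (lam ^ 2 - s ^ 2) ≤ (a * (lam + s) + b * (lam - s)) ^ 2 := by
        nlinarith [e₂, hab]
      have e₃ : 2 * (lam - s) * (lam + s) ≤ lam * (a * (lam + s) + b * (lam - s)) := by
        refine abs_le_of_sq_le_sq' ?_ (by positivity) |>.2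
        nlinarith [mul_le_mul_of_nonneg_left e₄ (sq_nonneg lam),
          mul_nonneg (mul_nonneg h₁.le h₂.le) (sq_nonneg s)]
      linarith
    have e₆ : G m = Real.exp (-lam * m) * (1 / lam - (Real.exp (s * m) / (2 * (lam - s)) +
        Real.exp (-(s * m)) / (2 * (lam + s)))) := by
      simp only [G]
      rw [show -(lam - s) * (m : ℝ) = -lam * m + s * m by ring,
        show -(lam + s) * (m : ℝ) = -lam * m + -(s * m) by ring, Real.exp_add, Real.exp_add]
      ring
    rw [e₆]
    exact mul_nonpos_of_nonneg_of_nonpos (Real.exp_pos _).le (by linarith)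
  have hG0 : G 0 = -(s ^ 2 / (lam * (lam ^ 2 - s ^ 2))) := by
    have : lam ^ 2 - s ^ 2 = (lam - s) * (lam + s) := by ring
    simp only [G, this, mul_zero, Real.exp_zero]
    field_simp
    ring
  refine (Finset.sum_le_sum fun i _ => hstep i).trans ?_
  rw [← Finset.mul_sum, Finset.sum_range_sub fun i : ℕ => G i]
  refine mul_le_mul_of_nonneg_left ?_ (Real.exp_pos _).le
  rw [Nat.cast_zero, hG0]
  linarith

variable {S : Type*} [MeasurableSpace S] {Q : Measure (CountingMeasure S)}
  {K lam s : ℝ}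

theorem measurable_size_real : Measurable fun μ : CountingMeasure S => (μ.size : ℝ) :=
  measurable_from_nat.comp measurable_size

theorem lintegral_cosh_sub_one_le [IsFiniteMeasure Q] (hK : 0 ≤ K)
    (hQ : ∀ m : ℕ, Q.real {μ | μ.size = m} ≤ K * Real.exp (-lam * m)) (hs : 0 ≤ s)
    (hsl : s < lam) :
    ∫⁻ μ, ENNReal.ofReal (Real.cosh (s * μ.size) - 1) ∂Q ≤
      ENNReal.ofReal (K * (Real.exp lam * (s ^ 2 / (lam * (lam ^ 2 - s ^ 2))))) := by
  have hc : ∀ m : ℕ, 0 ≤ Real.cosh (s * m) - 1 := fun m => sub_nonneg.2 (Real.one_le_cosh _)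
  rw [← lintegral_map (f := fun m : ℕ => ENNReal.ofReal (Real.cosh (s * m) - 1))
    measurable_from_nat measurable_size, lintegral_countable']
  have hterm : ∀ m : ℕ, ENNReal.ofReal (Real.cosh (s * m) - 1) *
      Q.map CountingMeasure.size {m} ≤
        ENNReal.ofReal (K * (Real.exp (-lam * m) * (Real.cosh (s * m) - 1))) := by
    intro m
    rw [Measure.map_apply measurable_size (measurableSet_singleton m)]
    have : Q (CountingMeasure.size ⁻¹' {m}) ≤ ENNReal.ofReal (K * Real.exp (-lam * m)) := by
      rw [← ofReal_measureReal]
      exact ENNReal.ofReal_le_ofReal (hQ m)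
    refine (mul_le_mul_right this _).trans_eq ?_
    rw [← ENNReal.ofReal_mul (hc m)]
    congr 1
    ring
  refine (ENNReal.tsum_le_tsum hterm).trans (ENNReal.tsum_le_of_sum_range_le fun m => ?_)
  rw [← ENNReal.ofReal_sum_of_nonneg fun i _ =>
    mul_nonneg hK (mul_nonneg (Real.exp_pos _).le (hc i)), ← Finset.mul_sum]
  exact ENNReal.ofReal_le_ofReal (mul_le_mul_of_nonneg_left (sum_exp_mul_cosh_sub_one_le hs hsl m) hK)

theorem lintegral_exp_size_ne_top [IsFiniteMeasure Q] (hK : 0 ≤ K)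
    (hQ : ∀ m : ℕ, Q.real {μ | μ.size = m} ≤ K * Real.exp (-lam * m)) (hs : 0 ≤ s)
    (hsl : s < lam) : ∫⁻ μ, ENNReal.ofReal (Real.exp (s * μ.size)) ∂Q ≠ ∞ := by
  have h := ne_top_of_le_ne_top ENNReal.ofReal_ne_top (lintegral_cosh_sub_one_le hK hQ hs hsl)
  have hle : ∀ μ : CountingMeasure S, ENNReal.ofReal (Real.exp (s * μ.size)) ≤
      2 * ENNReal.ofReal (Real.cosh (s * μ.size) - 1) + 2 := by
    intro μ
    have hc : 0 ≤ Real.cosh (s * μ.size) - 1 := sub_nonneg.2 (Real.one_le_cosh _)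
    rw [show (2 : ℝ≥0∞) = ENNReal.ofReal 2 by simp, ← ENNReal.ofReal_mul (by norm_num),
      ← ENNReal.ofReal_add (by positivity) (by norm_num)]
    refine ENNReal.ofReal_le_ofReal ?_
    rw [Real.cosh_eq]
    have := Real.exp_pos (-(s * μ.size))
    linarith
  refine ne_top_of_le_ne_top ?_ (lintegral_mono hle)
  rw [lintegral_add_right _ measurable_const, lintegral_const_mul' _ _ (by simp)]
  simp [ENNReal.mul_eq_top, h]

theorem integrable_size [IsFiniteMeasure Q] (hK : 0 ≤ K) (hlam : 0 < lam)
    (hQ : ∀ m : ℕ, Q.real {μ | μ.size = m} ≤ K * Real.exp (-lam * m)) :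
    Integrable (fun μ : CountingMeasure S => (μ.size : ℝ)) Q := by
  have hs : 0 < lam / 2 := by positivity
  have h := lintegral_exp_size_ne_top hK hQ hs.le (half_lt_self hlam)
  have hint : Integrable (fun μ : CountingMeasure S => Real.exp (lam / 2 * μ.size)) Q := by
    refine ⟨(Real.measurable_exp.comp
      (measurable_size_real.const_mul _)).aestronglyMeasurable, ?_⟩
    rw [hasFiniteIntegral_iff_ofReal (.of_forall fun x => (Real.exp_pos _).le)]
    exact lt_top_iff_ne_top.2 h
  refine (hint.const_mul (lam / 2)⁻¹).mono' measurable_size_real.aestronglyMeasurable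
    (.of_forall fun μ => ?_)
  rw [Real.norm_of_nonneg (by positivity), ← div_eq_inv_mul, le_div_iff₀ hs]
  linarith [Real.add_one_le_exp (lam / 2 * (μ.size : ℝ))]

end ExponentialTail

/-- The optimized Chernoff exponent. -/
theorem chernoff_exponent_le {K lam R c N ε : ℝ} (hK : 0 < K) (hlam : 0 < lam) (hR : 0 < R)
    (hc : 0 < c) (hN : 0 < N) (hε : 0 < ε) {D t : ℝ}
    (hD : D = 16 * K * Real.exp lam * R ^ 2 * (N * c ^ 2) + 4 * lam ^ 2 * ε * R * c)
    (ht : t = 2 * ε * lam ^ 3 / D) :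
    0 ≤ t ∧ t * (c * R) < lam ∧
      N * (2 * (K * (Real.exp lam * ((t * (c * R)) ^ 2 /
        (lam * (lam ^ 2 - (t * (c * R)) ^ 2)))))) - t * ε ≤ -(ε ^ 2 * lam ^ 3 / D) := by
  have hE : 0 < Real.exp lam := Real.exp_pos _
  set E := Real.exp lam
  have hD₀ : 0 < D := by rw [hD]; positivity
  have ht₀ : 0 < t := by rw [ht]; positivity
  have htD : t * D = 2 * ε * lam ^ 3 := by rw [ht]; field_simp
  set s := t * (c * R) with hs
  have hs₀ : 0 < s := by positivity
  -- The identity `t D = 2ελ³` in terms of `s`. Positivity of the first summand forces `2s < λ`;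
  -- solving for that summand makes the quadratic term comparable with `tε`.
  have hV : s * (16 * K * E * R * (N * c)) + 4 * lam ^ 2 * ε * s = 2 * ε * lam ^ 3 := by
    rw [← htD, hD, hs]; ring
  have hs2 : 2 * s < lam := by
    have h₁ : 0 < s * (16 * K * E * R * (N * c)) := by positivity
    have h₂ : 4 * lam ^ 2 * ε * s < 2 * ε * lam ^ 3 := by linarith
    have h₃ : (2 * lam ^ 2 * ε) * (2 * s) < (2 * lam ^ 2 * ε) * lam := by linarith
    exact lt_of_mul_lt_mul_left h₃ (by positivity)
  refine ⟨ht₀.le, by linarith, ?_⟩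
  have hd : 0 < lam ^ 2 - s ^ 2 := by nlinarith
  -- The moment term uses up at most half of `tε`; the other half is exactly the claimed exponent.
  have hmain : N * (2 * (K * (E * (s ^ 2 / (lam * (lam ^ 2 - s ^ 2)))))) ≤ t * ε / 2 := by
    rw [show N * (2 * (K * (E * (s ^ 2 / (lam * (lam ^ 2 - s ^ 2)))))) =
      2 * N * K * E * s ^ 2 / (lam * (lam ^ 2 - s ^ 2)) by ring, div_le_iff₀ (by positivity)]
    have h₁ : 8 * (2 * N * K * E * s ^ 2) = t * (2 * ε * lam ^ 2 * (lam - 2 * s)) := by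
      have : 8 * (2 * N * K * E * s ^ 2) = t * (s * (16 * K * E * R * (N * c))) := by
        rw [hs]; ring
      rw [this]
      congr 1
      linarith
    have h₂ : lam ^ 2 * (lam - 2 * s) ≤ 2 * (lam * (lam ^ 2 - s ^ 2)) := by
      have h₄ : 0 ≤ s * (2 * lam - s) := mul_nonneg hs₀.le (by linarith)
      linarith [mul_nonneg hlam.le (add_nonneg hd.le h₄)]
    have h₃ := mul_le_mul_of_nonneg_left h₂ (show 0 ≤ 2 * (t * ε) by positivity)
    linarith
  have hhalf : ε ^ 2 * lam ^ 3 / D = t * ε / 2 := by rw [ht]; ring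
  rw [hhalf]
  linarith

/-! ### The concentration inequality -/

theorem corollary1 {S Ω : Type*}
    -- the bounded (separable) metric space `(S, ρ)`
    [MetricSpace S] [TopologicalSpace.SeparableSpace S] [MeasurableSpace S] [BorelSpace S]
    (hS : Bornology.IsBounded (Set.univ : Set S))
    -- a metric on `S ∪ {s_α} = Option S` that extends `ρ`, with `inf_s ρ(s, s_α) = α`
    [MetricSpace (Option S)] (hext : Isometry (some : S → Option S))
    (α : ℝ) (hα : IsGLB (Set.range fun s : S => dist (some s) (none : Option S)) α)
    -- the point process `η`, with exponential tails
    [MeasurableSpace Ω] (P : Measure Ω) [IsProbabilityMeasure P]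
    (η : Ω → CountingMeasure S) (hη : Measurable η)
    (K₁ lam : ℝ) (hK₁ : 0 < K₁) (hlam : 0 < lam)
    (hA2 : ∀ m : ℕ, P.real {ω | (η ω).size = m} ≤ K₁ * Real.exp (-lam * m))
    -- the sample `η₁, …, η_n` of i.i.d. realizations of `η`
    (n : ℕ) (hn : 1 ≤ n) (ηs : Fin n → Ω → CountingMeasure S)
    (hmeas : ∀ i, Measurable (ηs i)) (hindep : iIndepFun ηs P)
    (hident : ∀ i, IdentDistrib (ηs i) η P P)
    (p : ℝ) (hp : 1 ≤ p) :
    (∀ ω, wassersteinDist p (empiricalMeasure fun i => ηs i ω) (P.map η) ≠ ∞) ∧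
    Integrable
      (fun ω => (wassersteinDist p (empiricalMeasure fun i => ηs i ω) (P.map η)).toReal) P ∧
    ∀ ε : ℝ, 0 < ε →
      P.real {ω | (wassersteinDist p (empiricalMeasure fun i => ηs i ω) (P.map η)).toReal
          - (∫ ω', (wassersteinDist p (empiricalMeasure fun i => ηs i ω') (P.map η)).toReal ∂P)
            > ε}
        ≤ Real.exp (-(ε ^ 2 * lam ^ 3 /
            (16 * K₁ * Real.exp lam * (Metric.diam (Set.univ : Set S) + α) ^ 2
                * (n : ℝ) ^ (1 - 2 / p)
              + 4 * lam ^ 2 * ε * (Metric.diam (Set.univ : Set S) + α)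
                * (n : ℝ) ^ (-1 / p)))) := by
  have hn₀ : n ≠ 0 := by omega
  have hn' : (0 : ℝ) < n := by positivity
  -- The empty set has no greatest lower bound in `ℝ`, so `hα` forces `S` to be nonempty.
  obtain ⟨s₀⟩ : Nonempty S := by
    by_contra h
    rw [not_nonempty_iff] at h
    have : α + 1 ≤ α := hα.2 (by rintro _ ⟨s, -⟩; exact isEmptyElim s)
    linarith
  have : Nonempty S := ⟨s₀⟩
  have : Nonempty (CountingMeasure S) := ⟨sumDirac fun _ : Fin 1 => s₀⟩
  set R := Metric.diam (Set.univ : Set S) + α with hRdef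
  have hα₀ : 0 ≤ α := hα.2 (by rintro _ ⟨s, rfl⟩; exact dist_nonneg)
  have hdiam : ∀ a b : S, dist (some a) (some b) ≤ Metric.diam (Set.univ : Set S) := fun a b => by
    rw [hext.dist_eq]
    exact Metric.dist_le_diam_of_mem hS trivial trivial
  have hnone : ∀ a : S, dist (some a) none ≤ R := by
    intro a
    have : dist (some a) none - Metric.diam (Set.univ : Set S) ≤ α := hα.2 <| by
      rintro _ ⟨s, rfl⟩
      have := dist_triangle (some a) (some s) none
      have := hdiam a s
      simp only
      linarith
    linarith
  -- Either of `diam(S)` and `α` may vanish; the sum is positive because `s_α` is not a point of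
  -- `S`.
  have hR₀ : 0 < R := (dist_pos.2 (Option.some_ne_none s₀)).trans_le (hnone s₀)
  have hR : ∀ a b : Option S, dist a b ≤ R := by
    rintro (_ | a) (_ | b)
    · simpa using hR₀.le
    · rw [dist_comm]; exact hnone b
    · exact hnone a
    · exact (hdiam a b).trans (by linarith)
  set Q := P.map η with hQdef
  have : IsProbabilityMeasure Q := Measure.isProbabilityMeasure_map hη.aemeasurable
  have hQ : ∀ m : ℕ, Q.real {μ | μ.size = m} ≤ K₁ * Real.exp (-lam * m) := by
    intro m
    have hm : MeasurableSet {μ : CountingMeasure S | μ.size = m} :=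
      measurable_size (measurableSet_singleton m)
    rw [hQdef, map_measureReal_apply hη hm]
    exact hA2 m
  have hlaw : P.map (fun ω i => ηs i ω) = Measure.pi fun _ => Q := by
    rw [(iIndepFun_iff_map_fun_eq_pi_map fun i => (hmeas i).aemeasurable).1 hindep]
    congr 1
    ext1 i
    exact (hident i).map_eq
  have hηs : Measurable fun ω i => ηs i ω := measurable_pi_lambda _ hmeas
  have hfin : ∀ μ : Fin n → CountingMeasure S,
      wassersteinDist p (empiricalMeasure μ) Q ≠ ∞ := by
    intro μ
    have : IsProbabilityMeasure (empiricalMeasure μ) := ⟨by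
      simp [empiricalMeasure, Measure.finsetSum_apply,
        ENNReal.inv_mul_cancel (show (n : ℝ≥0∞) ≠ 0 by simpa using hn₀)]⟩
    refine wassersteinDist_ne_top hR₀.le hR hp (half_pos hlam) ?_
      (lintegral_exp_size_ne_top hK₁.le hQ (half_pos hlam).le (half_lt_self hlam))
    simp only [empiricalMeasure, lintegral_smul_measure, lintegral_finsetSum_measure,
      lintegral_dirac, smul_eq_mul]
    exact ENNReal.mul_ne_top (by simpa using hn₀)
      (ENNReal.sum_ne_top.2 fun i _ => ENNReal.ofReal_ne_top)
  let F : (Fin n → CountingMeasure S) → ℝ := fun μ =>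
    (wassersteinDist p (empiricalMeasure μ) Q).toReal
  have hFm : Measurable F :=
    (measurable_wassersteinDist_empiricalMeasure hext hp hn₀).ennreal_toReal
  set c : ℝ := (n : ℝ) ^ (-1 / p) with hc
  have hc₀ : 0 < c := Real.rpow_pos_of_pos hn' _
  let h : CountingMeasure S → ℝ := fun μ => c * R * μ.size
  have hhm : Measurable h := measurable_size_real.const_mul _
  have hhi : Integrable h Q := (integrable_size hK₁.le hlam hQ).const_mul _
  have hh₀ : ∀ μ, 0 ≤ h μ := fun μ => by positivity
  have hle : ∀ (μ : Fin n → CountingMeasure S) (i : Fin n) (ν : CountingMeasure S)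
      {μ₁ μ₂ : Fin n → CountingMeasure S},
      (μ₁ = μ ∧ μ₂ = Function.update μ i ν ∨ μ₂ = μ ∧ μ₁ = Function.update μ i ν) →
        F μ₁ ≤ F μ₂ + c * D1 (μ i) ν := by
    intro μ i ν μ₁ μ₂ hμ
    have h₁ := wassersteinDist_empiricalMeasure_le_update (Q := Q) hext hp hn₀ μ i ν hμ
    have h₂ := ENNReal.toReal_mono (ENNReal.add_ne_top.2 ⟨hfin _, ENNReal.ofReal_ne_top⟩) h₁
    rwa [ENNReal.toReal_add (hfin _) ENNReal.ofReal_ne_top,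
      ENNReal.toReal_ofReal (mul_nonneg hc₀.le (D1_nonneg _ _))] at h₂
  have hF : ∀ μ i ν, |F μ - F (Function.update μ i ν)| ≤ max (h (μ i)) (h ν) := by
    intro μ i ν
    have h₁ := hle μ i ν (Or.inl ⟨rfl, rfl⟩)
    have h₂ := hle μ i ν (Or.inr ⟨rfl, rfl⟩)
    have h₃ : c * D1 (μ i) ν ≤ max (h (μ i)) (h ν) := by
      simp only [h]
      rw [← mul_max_of_nonneg _ _ (by positivity), mul_assoc]
      exact mul_le_mul_of_nonneg_left (D1_le_mul_max hR _ _) hc₀.le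
    exact abs_sub_le_iff.2 ⟨by linarith, by linarith⟩
  have hFi := integrable_pi_of_update hFm hhi hh₀ hF
  refine ⟨fun ω => hfin _, ?_, fun ε hε => ?_⟩
  · rw [← hlaw] at hFi
    exact hFi.comp_measurable hηs
  -- The power of `n` in the variance term: `n` coordinates, each contributing the square of `c =
  -- n^(-1/p)`.
  · have hnc : (n : ℝ) ^ (1 - 2 / p) = n * c ^ 2 := by
      rw [hc, ← Real.rpow_natCast, ← Real.rpow_mul hn'.le, Real.rpow_sub hn', Real.rpow_one,
        show -1 / p * ((2 : ℕ) : ℝ) = -(2 / p) by push_cast; ring, Real.rpow_neg hn'.le,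
        div_eq_mul_inv]
    rw [hnc]
    obtain ⟨ht, hts, hexp⟩ := chernoff_exponent_le hK₁ hlam hR₀ hc₀ hn' hε rfl rfl
    refine le_trans (le_of_eq ?_) ((measureReal_pi_sub_integral_gt_le hhm hhi hh₀ ht
      (a := _) ?_ ?_ hFm hF ε).trans (Real.exp_le_exp.2 hexp))
    · rw [← hlaw, integral_map hηs.aemeasurable hFm.aestronglyMeasurable,
        map_measureReal_apply hηs (measurableSet_lt measurable_const (hFm.sub_const _))]
      rfl
    · refine le_trans (le_of_eq ?_) (lintegral_cosh_sub_one_le hK₁.le hQ (by positivity) hts)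
      refine lintegral_congr fun μ => ?_
      simp only [h]
      rw [← mul_assoc]
    · have := sq_lt_sq' (by linarith [mul_nonneg ht (mul_pos hc₀ hR₀).le]) hts
      have : 0 < lam ^ 2 - _ := sub_pos.2 this
      positivity
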